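/- \textbf{Computations.} A computation is built from sequential pieces of code (leaves), binary forks (a task performs a head, forks two tasks, and performs a tail, its up-pass, after both are completed), and sequential composition. The size of a task is the number of words it accesses. Fix constants $K$, $0<\alpha<1$, $0<c_1\le 1\le c_2$ ($K$ bounds every ``$O(1)$''). A BP computation is a binary tree of forks with $O(1)$ operations at each node and such that a task at level $i$ has size between $c_1\alpha^i r$ and $c_2\alpha^i r$, where $r\ge1$ is the size of the root. HBP computations: a leaf with $O(1)$ operations has type $0$; a BP computation has type $1$; a sequence of computations of types $t_1,t_2$ has type $\max\{t_1,t_2\}$; and a computation has type $t+1$ ($t\ge 1$) if, on an input of size $n$, it calls in succession $c\ge1$ collections of $v(n)\ge1$ parallel recursive subproblems of size at most $s(n)\le n/b(n)$, $b(n)>1$ (each collection being forked by a BP-like tree of depth $\lceil\log_2 v(n)\rceil$, and possibly preceded and followed by HBP computations of type at most $t$), the recursion ending in computations of type at most $t$. It is balanced if the recursive problems at each level of a recursion have sizes within a factor $c_2/c_1$ of each other; and every written word is accessed $O(1)$ times. \textbf{Collections.} A collection $H=\{h_1,\dots,h_k\}$ in a computation $\Pi$ consists of $k$ distinct (hence pairwise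 parallel) subcomputations of $\Pi$ that occur at the same place of $\Pi$ up to the choice of the branches of forks and of the recursive subproblems of a collection. \textbf{PWS.} Subcomputations have integer priorities that decrease strictly with depth in the computation dag (a subcomputation starting at the same node as a larger one has priority at most that of the larger one) and that are equal for any two subcomputations at the same place in the above sense; so within a collection all nodes at the same depth have the same priority. There are $p$ cores with one task queue each; one core starts with $\Pi$, the others are idle, and cores proceed asynchronously. A core executing a fork puts the second forked task at the bottom of its queue and continues with the first; having completed the first, it resumes the second if it is still on its queue. The core that executes the last of two forked tasks to finish completes their parent; otherwise a core whose sibling task was stolen becomes idle. Steals take place in rounds: in a round of priority $d$, idle cores steal tasks of priority $d$ from the heads (tops) of queues; the round concludes when no head of a queue has priority $d$ and every non-idle core has a task on its queue, and then the priority of the next round is the highest priority of a task at the head of a queue. \textbf{Usurpers.} Let $H_1=\{h_{11},\dots,h_{1k}\}$ and $H_2=\{h_{21},\dots,h_{2k}\}$ be collections such that, for each $i$, $h_{2i}$ follows $h_{1i}$ in the sequential computation. A core $C'$ is a usurper at $h_{2i}$ if $C'$ starts $h_{2i}$, another core started $h_{1i}$, and $C'$ stole a proper subtask within $h_{1i}$.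 A core $C$ is semi-usurped at $h_{2i}$ if $C$ started both $h_{1i}$ and $h_{2i}$, but, during $h_{1i}$, $C$ did not access some word that is accessed both by $h_{1i}$ and by $h_{2i}$. \textbf{Lemma.} Let $\Pi$ be a balanced HBP computation scheduled under PWS on $p$ cores, and let $H_1,H_2$ be two collections in $\Pi$ such that $h_{2i}$ follows $h_{1i}$ in the sequential computation for $i=1,\dots,k$. Then there are at most $p-1$ usurpers and semi-usurpers altogether: the number of pairs $(i,C)$ such that the core $C$ is a usurper or is semi-usurped at $h_{2i}$ is at most $p-1$. -/

import Mathlib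

/-! ## Multithreaded computations with binary forking -/

namespace PWS

/-- An elementary operation: the word it accesses, and whether it writes (`true`) or reads. -/
abbrev Op (W : Type*) := W × Bool

/-- Series-parallel computations over a memory with words `W`.
* `leaf a` : a sequential piece of code performing the operations `a`;
* `fork head l r tail` : a task that performs its task head, forks the tasks `l` and `r`, and,
  after both are completed, performs `tail` in the up-pass;
* `seq x y` : the computation `x` followed by the computation `y`;
* `call n x` : a recursive subproblem with input size `n`, carried out by `x`.  It costs nothing;
  it only marks the leaves of the forking tree of a collection of recursive subproblems. -/
inductive Comp (W : Type*) where
  | leaf (a : List (Op W))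
  | fork (head : List (Op W)) (l r : Comp W) (tail : List (Op W))
  | seq (x y : Comp W)
  | call (n : ℕ) (x : Comp W)

namespace Comp

variable {W : Type*}

/-- All operations of a computation, in sequential order. -/
def ops : Comp W → List (Op W)
  | leaf a => a
  | fork h l r t => h ++ l.ops ++ r.ops ++ t
  | seq x y => x.ops ++ y.ops
  | call _ x => x.ops

/-- The data (words) accessed by a computation. -/
def words (x : Comp W) : Set W := {w | ∃ o ∈ x.ops, o.1 = w}

/-- The size `|τ|` of a task: the number of words it accesses. -/
noncomputable def size (x : Comp W) : ℕ := x.words.ncard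

open Classical in
/-- Limited access: each word that is written is accessed at most `K` times in all. -/
def LimitedAccess (K : ℕ) (x : Comp W) : Prop :=
  ∀ w, (w, true) ∈ x.ops → (x.ops.filter (fun o => o.1 = w)).length ≤ K

/-- The recursive subproblems, with their input sizes, at the leaves of a forking tree. -/
def callees : Comp W → List (ℕ × Comp W)
  | call n x => [(n, x)]
  | fork _ l r _ => l.callees ++ r.callees
  | _ => []

/-- The nodes at level `i` of the tree of forks at the top of a computation. -/
def level : ℕ → Comp W → List (Comp W)
  | 0, x => [x]
  | i + 1, fork _ l r _ => level i l ++ level i r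
  | _ + 1, _ => []

/-- The height of the tree of forks at the top of a computation. -/
def forkHeight : Comp W → ℕ
  | fork _ l r _ => max l.forkHeight r.forkHeight + 1
  | _ => 0

/-- The computation is a binary tree of forks with `O(1)` work per node whose leaves are
recursive subproblems. -/
def IsForking (K : ℕ) : Comp W → Prop
  | call _ _ => True
  | fork h l r t => h.length ≤ K ∧ t.length ≤ K ∧ l.IsForking K ∧ r.IsForking K
  | _ => False

/-- The BP-like forking tree of a collection of `v` recursive subproblems: depth `⌈log₂ v⌉`, and
all nodes of a level have the same number of subproblems up to a constant factor. -/
def IsForkingTree (K v : ℕ) (x : Comp W) : Prop :=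
  x.IsForking K ∧ x.callees.length = v ∧ x.forkHeight ≤ Nat.clog 2 v ∧
    ∀ i, ∀ y ∈ level i x, ∀ z ∈ level i x, y.callees.length ≤ K * z.callees.length

end Comp

/-! ## Balanced HBP computations -/

/-- The constants of the definition of HBP computations; `K` bounds every `O(1)`. -/
structure Constants where
  K : ℕ
  α : ℝ
  c₁ : ℝ
  c₂ : ℝ
  α_pos : 0 < α
  α_lt_one : α < 1
  c₁_pos : 0 < c₁
  c₁_le_one : c₁ ≤ 1
  one_le_c₂ : 1 ≤ c₂

/-- The parameters of a recursive algorithm that, on an input of size `n`, calls in succession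
`c` collections of `v n` parallel recursive subproblems, of size at most `s n ≤ n / b n`. -/
structure Recursion where
  c : ℕ
  v : ℕ → ℕ
  s : ℕ → ℕ
  b : ℕ → ℝ
  one_le_c : 1 ≤ c
  one_le_v : ∀ n, 1 ≤ v n
  one_lt_b : ∀ n, 1 < b n
  s_le : ∀ n, (s n : ℝ) ≤ n / b n

variable {W : Type*}

/-- `x` is a subtree at level `i` of a BP tree whose root has size `r`: every node performs `O(1)`
work in the down-pass and in the up-pass, and the balance condition holds. -/
def BPFrom (P : Constants) (r : ℕ) : ℕ → Comp W → Prop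
  | i, .leaf a =>
      a.length ≤ P.K ∧
      P.c₁ * P.α ^ i * r ≤ (Comp.leaf a).size ∧ ((Comp.leaf a).size : ℝ) ≤ P.c₂ * P.α ^ i * r
  | i, .fork h x y t =>
      (h.length ≤ P.K ∧ t.length ≤ P.K) ∧
      (P.c₁ * P.α ^ i * r ≤ (Comp.fork h x y t).size ∧
        ((Comp.fork h x y t).size : ℝ) ≤ P.c₂ * P.α ^ i * r) ∧
      BPFrom P r (i + 1) x ∧ BPFrom P r (i + 1) y
  | _, .seq _ _ => False
  | _, .call _ _ => False

/-- BP computations (limited access is imposed on the whole HBP computation). -/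
def IsBP (P : Constants) (x : Comp W) : Prop := 1 ≤ x.size ∧ BPFrom P x.size 0 x

mutual

/-- Balanced HBP computations of a given type, up to the limited access condition. -/
inductive HBP (P : Constants) : ℕ → Comp W → Prop
  | type0 {a : List (Op W)} : a.length ≤ P.K → HBP P 0 (.leaf a)
  | bp {x : Comp W} : IsBP P x → HBP P 1 x
  | seq {t₁ t₂ : ℕ} {x y : Comp W} : HBP P t₁ x → HBP P t₂ y → HBP P (max t₁ t₂) (.seq x y)
  | recursive {t n : ℕ} {x : Comp W} (R : Recursion) (lo : ℕ → ℝ) :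
      1 ≤ t → HBPCall P R lo t 0 n x → HBP P (t + 1) x

/-- `HBPCall P R lo t d n x`: `x` is the call, at level `d` of the recursion, of a recursive
algorithm of type `t + 1` with parameters `R` on an input of size `n`.  Balance: the sizes of the
recursive problems at level `d` all lie in `[lo d, (c₂ / c₁) * lo d]`, that is, they are within a
factor `c₂ / c₁` of each other.  The recursion ends in computations of type at most `t`. -/
inductive HBPCall (P : Constants) : Recursion → (ℕ → ℝ) → ℕ → ℕ → ℕ → Comp W → Prop
  | base {R : Recursion} {lo : ℕ → ℝ} {t t' d n : ℕ} {x : Comp W} :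
      1 ≤ n → lo d ≤ n → (n : ℝ) ≤ P.c₂ / P.c₁ * lo d → t' ≤ t → HBP P t' x →
      HBPCall P R lo t d n x
  | step {R : Recursion} {lo : ℕ → ℝ} {t d n : ℕ} {x : Comp W} :
      1 ≤ n → lo d ≤ n → (n : ℝ) ≤ P.c₂ / P.c₁ * lo d → HBPBody P R lo t d n R.c x →
      HBPCall P R lo t d n x

/-- `HBPBody P R lo t d n m x`: `x` runs in succession `m` collections of recursive subproblems of
a call on an input of size `n` at level `d`, each possibly preceded and followed by HBP
computations of type at most `t`. -/
inductive HBPBody (P : Constants) : Recursion → (ℕ → ℝ) → ℕ → ℕ → ℕ → ℕ → Comp W → Prop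
  | collection {R : Recursion} {lo : ℕ → ℝ} {t d n : ℕ} {x : Comp W} :
      x.IsForkingTree P.K (R.v n) →
      (∀ m y, (m, y) ∈ x.callees → m ≤ R.s n) →
      (∀ m y, (m, y) ∈ x.callees → HBPCall P R lo t (d + 1) m y) →
      HBPBody P R lo t d n 1 x
  | before {R : Recursion} {lo : ℕ → ℝ} {t t' d n m : ℕ} {x y : Comp W} :
      t' ≤ t → HBP P t' y → HBPBody P R lo t d n m x → HBPBody P R lo t d n m (.seq y x)
  | after {R : Recursion} {lo : ℕ → ℝ} {t t' d n m : ℕ} {x y : Comp W} :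
      t' ≤ t → HBPBody P R lo t d n m x → HBP P t' y → HBPBody P R lo t d n m (.seq x y)
  | append {R : Recursion} {lo : ℕ → ℝ} {t d n m m' : ℕ} {x y : Comp W} :
      HBPBody P R lo t d n m x → HBPBody P R lo t d n m' y →
      HBPBody P R lo t d n (m + m') (.seq x y)

end

/-- `x` is a balanced HBP computation of type `t`. -/
def IsBalancedHBP (P : Constants) (t : ℕ) (x : Comp W) : Prop :=
  x.LimitedAccess P.K ∧ HBP P t x

/-! ## Positions (tasks) and their priorities -/

/-- A step from a computation to an immediate subcomputation. -/
inductive Dir where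
  | seqL | seqR | forkL | forkR | call

/-- A subcomputation is named by its path from the root. -/
abbrev Path := List Dir

/-- The subcomputation at a path, if there is one. -/
def Comp.sub : Comp W → Path → Option (Comp W)
  | x, [] => some x
  | .seq x _, .seqL :: q => x.sub q
  | .seq _ y, .seqR :: q => y.sub q
  | .fork _ l _ _, .forkL :: q => l.sub q
  | .fork _ _ r _, .forkR :: q => r.sub q
  | .call _ x, .call :: q => x.sub q
  | _, _ :: _ => none

/-- `h₂` follows `h₁` in the sequential computation, through a sequential composition. -/
def Follows (h₁ h₂ : Path) : Prop :=
  ∃ w u v, h₁ = w ++ Dir.seqL :: u ∧ h₂ = w ++ Dir.seqR :: v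

/-- The first node of `q'` is strictly below the first node of `q` in the computation dag. -/
def Deeper (q q' : Path) : Prop :=
  (∃ u, q' = q ++ u ∧ (Dir.forkL ∈ u ∨ Dir.forkR ∈ u)) ∨ Follows q q'

/-- Forget in which of the two branches of a fork a step goes. -/
def Dir.erase : Dir → Dir
  | .forkR => .forkL
  | s => s

/-- The place of a subcomputation in the computation, irrespective of the parallel branch in which
it lies: the branches of forks are forgotten, and all the way down a forking tree to a recursive
subproblem counts as a single step `call`.  So the recursive subproblems of a collection have the
same place, and so do, throughout a collection, the nodes at the same depth. -/
def place : Path → Path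
  | [] => []
  | s :: q =>
    match s.erase, place q with
    | .forkL, .call :: r => .call :: r
    | e, r => e :: r

/-- Integer priorities as required by PWS: they decrease strictly with depth in the computation
dag, a part that starts where the whole starts does not have a larger priority than the whole, and
within a collection all nodes at the same depth have the same priority. -/
structure IsPriority (Pi : Comp W) (prio : Path → ℤ) : Prop where
  strict : ∀ q q', Pi.sub q ≠ none → Pi.sub q' ≠ none → Deeper q q' → prio q' < prio q
  mono : ∀ q q', Pi.sub q ≠ none → Pi.sub q' ≠ none → q <+: q' → prio q' ≤ prio q
  same : ∀ q q', Pi.sub q ≠ none → Pi.sub q' ≠ none → place q = place q' → prio q = prio q'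

/-! ## Priority work stealing -/

/-- What a core is doing: nothing, being about to start the part at `q`, or having completed
the part at `q` and being about to continue with what comes after it. -/
inductive Core where
  | idle
  | down (q : Path)
  | up (q : Path)

/-- Observable events. -/
inductive Event (p : ℕ) where
  /-- core `C` starts the computation at `q` (for a leaf or a fork: performs it, resp. its head) -/
  | start (C : Fin p) (q : Path)
  /-- core `C` performs, after the join, the up-pass work of the fork at `q` -/
  | join (C : Fin p) (q : Path)
  /-- core `thief` steals the task at `q` from the task queue of `victim` -/
  | steal (thief victim : Fin p) (q : Path)

/-- A configuration of `p` cores.  Each task queue is listed from its top (head) to its bottom;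
`done` holds the completed branches of forks; `round` is the priority of the current round. -/
structure Config (p : ℕ) where
  core : Fin p → Core
  queue : Fin p → List Path
  done : Set Path
  round : Option ℤ

/-- The task `q` is at the head of some task queue. -/
def Config.IsHead {p : ℕ} (s : Config p) (q : Path) : Prop := ∃ C ts, s.queue C = q :: ts

/-- `Sibling q a b`: `a` and `b` are the two branches of the fork at `q`. -/
def Sibling (q a b : Path) : Prop :=
  (a = q ++ [Dir.forkL] ∧ b = q ++ [Dir.forkR]) ∨ (a = q ++ [Dir.forkR] ∧ b = q ++ [Dir.forkL])

open Function in
/-- One atomic step of the computation `Pi` scheduled under PWS; the cores proceed asynchronously.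
-/
inductive Step {p : ℕ} (Pi : Comp W) (prio : Path → ℤ) :
    Config p → Option (Event p) → Config p → Prop
  | leaf {s : Config p} {C : Fin p} {q : Path} {a : List (Op W)} :
      s.core C = .down q → Pi.sub q = some (.leaf a) →
      Step Pi prio s (some (.start C q)) { s with core := update s.core C (.up q) }
  /-- the second forked task goes to the bottom of the queue, the core continues with the first -/
  | fork {s : Config p} {C : Fin p} {q : Path} {hd tl : List (Op W)} {l r : Comp W} :
      s.core C = .down q → Pi.sub q = some (.fork hd l r tl) →
      Step Pi prio s (some (.start C q))
        { s with
          core := update s.core C (.down (q ++ [Dir.forkL]))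
          queue := update s.queue C (s.queue C ++ [q ++ [Dir.forkR]]) }
  | seq {s : Config p} {C : Fin p} {q : Path} {x y : Comp W} :
      s.core C = .down q → Pi.sub q = some (.seq x y) →
      Step Pi prio s (some (.start C q))
        { s with core := update s.core C (.down (q ++ [Dir.seqL])) }
  | call {s : Config p} {C : Fin p} {q : Path} {n : ℕ} {x : Comp W} :
      s.core C = .down q → Pi.sub q = some (.call n x) →
      Step Pi prio s (some (.start C q))
        { s with core := update s.core C (.down (q ++ [Dir.call])) }
  | seqNext {s : Config p} {C : Fin p} {q : Path} :
      s.core C = .up (q ++ [Dir.seqL]) →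
      Step Pi prio s none { s with core := update s.core C (.down (q ++ [Dir.seqR])) }
  | seqEnd {s : Config p} {C : Fin p} {q : Path} :
      s.core C = .up (q ++ [Dir.seqR]) →
      Step Pi prio s none { s with core := update s.core C (.up q) }
  | callEnd {s : Config p} {C : Fin p} {q : Path} :
      s.core C = .up (q ++ [Dir.call]) →
      Step Pi prio s none { s with core := update s.core C (.up q) }
  /-- the second forked task is still on the core's own queue: the core executes it -/
  | resume {s : Config p} {C : Fin p} {q : Path} {ts : List Path} :
      s.core C = .up (q ++ [Dir.forkL]) → s.queue C = ts ++ [q ++ [Dir.forkR]] →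
      Step Pi prio s none
        { s with
          core := update s.core C (.down (q ++ [Dir.forkR]))
          queue := update s.queue C ts
          done := insert (q ++ [Dir.forkL]) s.done }
  /-- the core that executes the last of the two forked tasks to finish completes their parent -/
  | join {s : Config p} {C : Fin p} {q a b : Path} :
      s.core C = .up a → Sibling q a b → b ∉ s.queue C → b ∈ s.done →
      Step Pi prio s (some (.join C q))
        { s with core := update s.core C (.up q), done := insert a s.done }
  /-- otherwise the core becomes idle -/
  | wait {s : Config p} {C : Fin p} {q a b : Path} :
      s.core C = .up a → Sibling q a b → b ∉ s.queue C → b ∉ s.done →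
      Step Pi prio s none
        { s with core := update s.core C .idle, done := insert a s.done }
  | finish {s : Config p} {C : Fin p} :
      s.core C = .up [] →
      Step Pi prio s none { s with core := update s.core C .idle }
  /-- an idle core steals a task, of the priority of the current round, at the head of a queue -/
  | steal {s : Config p} {C V : Fin p} {q : Path} {ts : List Path} :
      s.core C = .idle → s.queue V = q :: ts → s.round = some (prio q) →
      Step Pi prio s (some (.steal C V q))
        { s with core := update s.core C (.down q), queue := update s.queue V ts }
  /-- the current round (if any) concludes: no task of its priority is at the head of a queue, and
  every non-idle core has generated a task on its queue; the priority of the next round is the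
  highest priority of a task at the head of a queue -/
  | newRound {s : Config p} {q : Path} :
      (∀ q', s.IsHead q' → s.round ≠ some (prio q')) →
      (∀ C, s.core C ≠ .idle → s.queue C ≠ []) →
      s.IsHead q → (∀ q', s.IsHead q' → prio q' ≤ prio q) →
      Step Pi prio s none { s with round := some (prio q) }

open Function in
/-- At the start, the core `C₀` is given the whole computation and all other cores are idle. -/
def Config.init {p : ℕ} (C₀ : Fin p) : Config p where
  core := update (fun _ => .idle) C₀ (.down [])
  queue := fun _ => []
  done := ∅
  round := none

/-- `Run Pi prio C₀ tr s`: an execution (complete or not) of `Pi` under PWS, started on core `C₀`,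
with the chronological list of events `tr`, has led to the configuration `s`. -/
inductive Run {p : ℕ} (Pi : Comp W) (prio : Path → ℤ) (C₀ : Fin p) :
    List (Event p) → Config p → Prop
  | init : Run Pi prio C₀ [] (Config.init C₀)
  | step {tr : List (Event p)} {s s' : Config p} {e : Option (Event p)} :
      Run Pi prio C₀ tr s → Step Pi prio s e s' → Run Pi prio C₀ (tr ++ e.toList) s'

/-! ## Collections, usurpers and semi-usurpers -/

/-- A collection of `k` parallel independent computations occurring in `Pi`: distinct
subcomputations at the same place of `Pi`, which therefore lie in different branches of forks. -/
structure IsCollection (Pi : Comp W) {k : ℕ} (H : Fin k → Path) : Prop where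
  valid : ∀ i, Pi.sub (H i) ≠ none
  injective : Function.Injective H
  samePlace : ∀ i j, place (H i) = place (H j)

/-- The operations performed when the part at `q` is started. -/
def Comp.startOps : Comp W → List (Op W)
  | .leaf a => a
  | .fork h _ _ _ => h
  | _ => []

/-- The operations performed after the join. -/
def Comp.joinOps : Comp W → List (Op W)
  | .fork _ _ _ t => t
  | _ => []

/-- In the execution with events `tr`, core `C` accesses the word `w` in the part of the
computation at `h` that it executes. -/
def Accesses {p : ℕ} (Pi : Comp W) (tr : List (Event p)) (C : Fin p) (h : Path) (w : W) : Prop :=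
  ∃ q x, h <+: q ∧ Pi.sub q = some x ∧
    ((Event.start C q ∈ tr ∧ ∃ o ∈ x.startOps, o.1 = w) ∨
     (Event.join C q ∈ tr ∧ ∃ o ∈ x.joinOps, o.1 = w))

/-- Core `C'` is a usurper at `h₂`: some other core `C` started the computation `h₁`, the core `C'`
stole a (proper) subtask within `h₁`, and it is `C'` that starts the computation `h₂`. -/
def IsUsurper {p : ℕ} (tr : List (Event p)) (h₁ h₂ : Path) (C' : Fin p) : Prop :=
  Event.start C' h₂ ∈ tr ∧
  (∃ C, C ≠ C' ∧ Event.start C h₁ ∈ tr) ∧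
  ∃ V q, Event.steal C' V q ∈ tr ∧ h₁ <+: q ∧ q ≠ h₁

/-- Core `C` is semi-usurped at `h₂`: it started both `h₁` and `h₂`, but it has not accessed in
`h₁` some of the data that are used in `h₁` and again in `h₂`. -/
def IsSemiUsurped {p : ℕ} (Pi : Comp W) (tr : List (Event p)) (h₁ h₂ : Path) (C : Fin p) : Prop :=
  Event.start C h₁ ∈ tr ∧ Event.start C h₂ ∈ tr ∧
  ∃ x₁ x₂ w, Pi.sub h₁ = some x₁ ∧ Pi.sub h₂ = some x₂ ∧ w ∈ x₁.words ∧ w ∈ x₂.words ∧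
    ¬ Accesses Pi tr C h₁ w

end PWS

namespace PWS

variable {W : Type*} {p : ℕ}

/-! ### Subcomputations -/

-- A usurper at `H₂ i` has stolen a proper subtask of `H₁ i`. A core semi-usurped at `H₂ i` implies
-- such a theft too: without one, the core that started `H₁ i` executes all of it (`Run.owner`), and
-- so accesses all its words (`IsSemiUsurped.stolenWithin`). Each `H₂ i` is started by only one
-- core, so it suffices that proper subtasks are stolen in at most `p - 1` members of `H₁`.
--
-- This is `Run.stolenWithin_collection`. At the first such theft the round has a priority below the
-- common priority of the members, so all of them have been started (`Run.started_of_round_lt`).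
-- Every unfinished member has a core inside it, different members have different cores, and the
-- thief, being idle, is in none. Hence at most `p - 1` members are unfinished, and finished members
-- offer nothing to steal.
--
-- Priorities enter through the end of a round: each busy core then has a queued right branch and
-- works inside the corresponding left branch, which has the same priority. Unstarted work lies in
-- or after a current position or a queued task, so its priority is at most the highest priority at
-- a queue head.
--
-- The rest is the invariant `Inv`. Its core is that the positions of cores and the queued tasks
-- (the tokens) are pairwise incomparable paths (`Inv.solo`), that each queue lists the pending
-- right branches on its core's path, and that unfinished work always contains a token.

theorem Comp.sub_nil (x : Comp W) : x.sub [] = some x := by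
  cases x <;> simp [Comp.sub]

theorem Comp.sub_append (x : Comp W) (q u : Path) :
    x.sub (q ++ u) = (x.sub q).bind (fun y => y.sub u) := by
  induction q generalizing x with
  | nil => simp [Comp.sub_nil]
  | cons d q ih => cases x <;> cases d <;> simp [Comp.sub, ih]

theorem Comp.sub_ne_none_of_prefix {x : Comp W} {q q' : Path} (h : q <+: q')
    (hq : x.sub q' ≠ none) : x.sub q ≠ none := by
  obtain ⟨u, rfl⟩ := h
  intro h0
  simp [Comp.sub_append, h0] at hq

theorem Comp.sub_concat {x y : Comp W} {q : Path} (d : Dir) (h : x.sub q = some y) :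
    x.sub (q ++ [d]) = y.sub [d] := by
  simp [Comp.sub_append, h]

theorem prefix_concat {q q' : Path} {d : Dir} :
    q <+: q' ++ [d] ↔ q = q' ++ [d] ∨ q <+: q' := List.prefix_concat_iff

theorem prefix_cases {q y : Path} (h : q <+: y) : y = q ∨ ∃ d, q ++ [d] <+: y := by
  obtain ⟨u, rfl⟩ := h
  cases u with
  | nil => simp
  | cons d u => exact Or.inr ⟨d, u, by simp⟩

theorem prefix_of_concat_prefix {q y : Path} {d : Dir} (h : q ++ [d] <+: y) : q <+: y :=
  (List.prefix_append _ _).trans h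

theorem eq_of_concat_prefix {q y : Path} {d d' : Dir} (h : q ++ [d] <+: y)
    (h' : q ++ [d'] <+: y) : d = d' := by
  obtain ⟨u, rfl⟩ := h
  obtain ⟨v, hv⟩ := h'
  simp at hv
  exact hv.1.symm

theorem not_concat_prefix {q : Path} {d : Dir} : ¬ q ++ [d] <+: q := by
  intro h
  have := h.length_le
  simp at this

theorem sub_children {x y : Comp W} {q : Path} {d : Dir} (h : x.sub q = some y)
    (hd : x.sub (q ++ [d]) ≠ none) :
    (∃ a b, y = .seq a b ∧ (d = .seqL ∨ d = .seqR)) ∨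
    (∃ hd a b tl, y = .fork hd a b tl ∧ (d = .forkL ∨ d = .forkR)) ∨
    (∃ n a, y = .call n a ∧ d = .call) := by
  rw [Comp.sub_concat d h] at hd
  cases y <;> cases d <;> simp_all [Comp.sub]

theorem sub_sibling {x : Comp W} {q a b : Path} (h : Sibling q a b) (ha : x.sub a ≠ none) :
    x.sub b ≠ none ∧ ∃ hd l r tl, x.sub q = some (.fork hd l r tl) := by
  have hq : x.sub q ≠ none := Comp.sub_ne_none_of_prefix (by
    rcases h with ⟨rfl, _⟩ | ⟨rfl, _⟩ <;> exact List.prefix_append _ _) ha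
  obtain ⟨y, hy⟩ := Option.ne_none_iff_exists'.1 hq
  rcases h with ⟨rfl, rfl⟩ | ⟨rfl, rfl⟩ <;>
  · rw [Comp.sub_concat _ hy] at ha
    rw [Comp.sub_concat _ hy]
    cases y <;> simp_all [Comp.sub, Comp.sub_nil]

theorem Sibling.symm {q a b : Path} (h : Sibling q a b) : Sibling q b a := by
  rcases h with h | h
  · exact Or.inr ⟨h.2, h.1⟩
  · exact Or.inl ⟨h.2, h.1⟩

theorem Sibling.not_prefix {q a b : Path} (h : Sibling q a b) : ¬ a <+: b := by
  rcases h with ⟨rfl, rfl⟩ | ⟨rfl, rfl⟩ <;> simp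

theorem Sibling.concat {q a b : Path} (h : Sibling q a b) :
    ∃ d, a = q ++ [d] ∧ (d = .forkL ∨ d = .forkR) := by
  rcases h with ⟨rfl, rfl⟩ | ⟨rfl, rfl⟩ <;> simp

/-- Every word used by a computation is accessed at the start or at the join of some part. -/
theorem Comp.exists_sub_of_mem_words {x : Comp W} {w : W} (hw : w ∈ x.words) :
    ∃ u y, x.sub u = some y ∧ ((∃ o ∈ y.startOps, o.1 = w) ∨ (∃ o ∈ y.joinOps, o.1 = w)) := by
  obtain ⟨o, ho, rfl⟩ := hw
  induction x with
  | leaf a => exact ⟨[], _, Comp.sub_nil _, Or.inl ⟨o, ho, rfl⟩⟩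
  | fork hd l r tl ihl ihr =>
    simp only [Comp.ops, List.mem_append] at ho
    rcases ho with ((ho | ho) | ho) | ho
    · exact ⟨[], _, Comp.sub_nil _, Or.inl ⟨o, ho, rfl⟩⟩
    · obtain ⟨u, y, hu, hy⟩ := ihl ho
      exact ⟨.forkL :: u, y, by simpa [Comp.sub] using hu, hy⟩
    · obtain ⟨u, y, hu, hy⟩ := ihr ho
      exact ⟨.forkR :: u, y, by simpa [Comp.sub] using hu, hy⟩
    · exact ⟨[], _, Comp.sub_nil _, Or.inr ⟨o, ho, rfl⟩⟩
  | seq a b iha ihb =>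
    simp only [Comp.ops, List.mem_append] at ho
    rcases ho with ho | ho
    · obtain ⟨u, y, hu, hy⟩ := iha ho
      exact ⟨.seqL :: u, y, by simpa [Comp.sub] using hu, hy⟩
    · obtain ⟨u, y, hu, hy⟩ := ihb ho
      exact ⟨.seqR :: u, y, by simpa [Comp.sub] using hu, hy⟩
  | call n a iha =>
    obtain ⟨u, y, hu, hy⟩ := iha ho
    exact ⟨.call :: u, y, by simpa [Comp.sub] using hu, hy⟩

/-! ### Places -/

theorem place_cons (s : Dir) (q : Path) :
    (∃ r, s.erase = .forkL ∧ place q = .call :: r ∧ place (s :: q) = .call :: r) ∨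
      place (s :: q) = s.erase :: place q := by
  rw [place]
  split
  · rename_i r h1 h2
    exact Or.inl ⟨r, h1, h2, rfl⟩
  · exact Or.inr rfl

/-- Thus `IsPriority.same` gives the two branches of a fork equal priority, which links a queued
task to the branch its core is executing. -/
theorem place_fork_concat (q : Path) : place (q ++ [.forkL]) = place (q ++ [.forkR]) := by
  induction q with
  | nil => simp [place, Dir.erase]
  | cons d q ih => simp only [List.cons_append, place, ih]

/-- Whether a step does not go into a branch of a fork. -/
def Dir.isSerial : Dir → Bool
  | .forkL => false
  | .forkR => false
  | _ => true

/-- Forgetting branches and absorbing a forking tree into a `call` only affect fork steps. -/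
theorem countP_isSerial_place (q : Path) :
    (place q).countP Dir.isSerial = q.countP Dir.isSerial := by
  induction q with
  | nil => simp [place]
  | cons d q ih =>
    rcases place_cons d q with ⟨r, h1, h2, h3⟩ | h
    · rw [h3, ← h2, ih]
      cases d <;> simp_all [Dir.erase, Dir.isSerial]
    · rw [h]
      cases d <;> simp_all [Dir.erase, Dir.isSerial, List.countP_cons]

/-- Equal places have equally many serial steps, so the extension consists of forks; a nonempty one
would strictly lower the priority, against `same`. This makes members of a collection incomparable.
-/
theorem IsPriority.eq_of_prefix {Pi : Comp W} {prio : Path → ℤ} (hprio : IsPriority Pi prio)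
    {q q' : Path} (hq : Pi.sub q ≠ none) (hq' : Pi.sub q' ≠ none) (hpl : place q = place q')
    (h : q <+: q') : q = q' := by
  obtain ⟨u, rfl⟩ := h
  have hcount := countP_isSerial_place (q ++ u)
  rw [← hpl, countP_isSerial_place, List.countP_append] at hcount
  have hu : ∀ d ∈ u, ¬ d.isSerial = true := List.countP_eq_zero.1 (by omega)
  cases u with
  | nil => simp
  | cons d u =>
    have := hprio.strict q _ hq hq' (Or.inl ⟨_, rfl, by
      have := hu d (by simp)
      cases d <;> simp_all [Dir.isSerial]⟩)
    rw [hprio.same _ _ hq hq' hpl] at this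
    omega

/-! ### Tokens: the places where a core is, and the tasks on the queues -/

/-- The part at `q` has been started. -/
def Started (tr : List (Event p)) (q : Path) : Prop := ∃ C, Event.start C q ∈ tr

/-- The part at `q` and everything inside it has been performed. -/
def Performed (Pi : Comp W) (tr : List (Event p)) (q : Path) : Prop :=
  ∀ q' x, q <+: q' → Pi.sub q' = some x →
    Started tr q' ∧ (∀ hd l r tl, x = .fork hd l r tl → ∃ C, Event.join C q' ∈ tr)

/-- Core `C` is at `q`. -/
def At (s : Config p) (C : Fin p) (q : Path) : Prop := s.core C = .down q ∨ s.core C = .up q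

/-- Core `C` is at `q` or has `q` on its queue. -/
def Tok (s : Config p) (C : Fin p) (q : Path) : Prop := At s C q ∨ q ∈ s.queue C

/-- The part at `q` is about to be started by core `C`, or is on its queue. -/
def Ready (s : Config p) (C : Fin p) (q : Path) : Prop := s.core C = .down q ∨ q ∈ s.queue C

/-- The part at `q` has been performed and left. -/
def Over (Pi : Comp W) (tr : List (Event p)) (s : Config p) (q : Path) : Prop :=
  Started tr q ∧ Performed Pi tr q ∧ ∀ C y, Tok s C y → ¬ q <+: y

theorem Started.mono {tr : List (Event p)} {q : Path} (h : Started tr q) (l : List (Event p)) :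
    Started (tr ++ l) q := by
  obtain ⟨C, h⟩ := h
  exact ⟨C, by simp [h]⟩

theorem Performed.mono {Pi : Comp W} {tr : List (Event p)} {q : Path} (h : Performed Pi tr q)
    (l : List (Event p)) : Performed Pi (tr ++ l) q := by
  intro q' x hq hx
  refine ⟨(h q' x hq hx).1.mono l, fun hd a b tl hf => ?_⟩
  obtain ⟨C, hC⟩ := (h q' x hq hx).2 hd a b tl hf
  exact ⟨C, by simp [hC]⟩

theorem performed_of_children {Pi : Comp W} {tr : List (Event p)} {q : Path}
    (h0 : Started tr q)
    (hj : ∀ hd l r tl, Pi.sub q = some (.fork hd l r tl) → ∃ C, Event.join C q ∈ tr)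
    (hc : ∀ d, Pi.sub (q ++ [d]) ≠ none → Performed Pi tr (q ++ [d])) : Performed Pi tr q := by
  intro q' x hq hx
  rcases prefix_cases hq with rfl | ⟨d, hd⟩
  · refine ⟨h0, ?_⟩
    rintro hd l r tl rfl
    exact hj _ _ _ _ hx
  · exact hc d (Comp.sub_ne_none_of_prefix hd (by simp [hx])) q' x hd hx

/-! ### Where the tokens after a step come from -/

theorem started_append {tr : List (Event p)} {e : Option (Event p)} {q : Path} :
    Started (tr ++ e.toList) q ↔ Started tr q ∨ ∃ C, e = some (.start C q) := by
  simp [Started, exists_or]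

variable {Pi : Comp W} {prio : Path → ℤ} {s s' : Config p} {e : Option (Event p)}

theorem Step.core_of_start (h : Step Pi prio s e s') {C : Fin p} {q : Path}
    (he : e = some (.start C q)) : s.core C = .down q := by
  cases h <;> simp_all

/-- The alternative `y ∈ s.queue C` covers `resume`. The clause `e ≠ some (.start C y)` serves
freshness: what was ready and remains so was not started by this step. -/
theorem Step.of_ready (h : Step Pi prio s e s') {C : Fin p} {y : Path} (hy : Ready s' C y) :
    (Ready s C y ∧ e ≠ some (.start C y) ∨ y ∈ s.queue C) ∨
    (∃ V, e = some (.steal C V y) ∧ y ∈ s.queue V) ∨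
    (∃ q d, y = q ++ [d] ∧ s.core C = .down q ∧ e = some (.start C q) ∧ d ≠ .seqR ∧
      Pi.sub y ≠ none) ∨
    (∃ q, y = q ++ [.seqR] ∧ s.core C = .up (q ++ [.seqL]) ∧ e = none) := by
  unfold Ready at hy ⊢
  cases h
  case fork q hd tl l r hc hq =>
    have h1 := Comp.sub_concat .forkL hq
    have h2 := Comp.sub_concat .forkR hq
    simp only [Comp.sub, Comp.sub_nil] at h1 h2
    simp only [Function.update_apply] at hy
    grind
  case seq q a b hc hq =>
    have h1 := Comp.sub_concat .seqL hq
    simp only [Comp.sub, Comp.sub_nil] at h1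
    simp only [Function.update_apply] at hy
    grind
  case call q n a hc hq =>
    have h1 := Comp.sub_concat .call hq
    simp only [Comp.sub, Comp.sub_nil] at h1
    simp only [Function.update_apply] at hy
    grind
  all_goals
    simp only [Function.update_apply] at hy
    grind

theorem Step.of_up (h : Step Pi prio s e s') {C : Fin p} {y : Path} (hy : s'.core C = .up y) :
    s.core C = .up y ∨
    (s.core C = .down y ∧ e = some (.start C y) ∧ ∃ a, Pi.sub y = some (.leaf a)) ∨
    (∃ d, (d = .seqR ∨ d = .call) ∧ s.core C = .up (y ++ [d]) ∧ e = none) ∨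
    (∃ a b, Sibling y a b ∧ s.core C = .up a ∧ b ∉ s.queue C ∧ b ∈ s.done ∧
      e = some (.join C y)) := by
  cases h <;> simp only [Function.update_apply] at hy <;> (try split at hy) <;> grind

theorem Step.of_tok (h : Step Pi prio s e s') {C : Fin p} {y : Path} (hy : Tok s' C y) :
    Tok s C y ∨
    (∃ V, e = some (.steal C V y) ∧ y ∈ s.queue V) ∨
    (∃ q d, y = q ++ [d] ∧ s.core C = .down q ∧ e = some (.start C q) ∧ d ≠ .seqR ∧
      Pi.sub y ≠ none ∧ Ready s' C y) ∨
    (∃ q, y = q ++ [.seqR] ∧ s.core C = .up (q ++ [.seqL]) ∧ e = none ∧ Ready s' C y) ∨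
    (∃ d, (d = .seqR ∨ d = .call) ∧ s.core C = .up (y ++ [d]) ∧ e = none) ∨
    (∃ a b, Sibling y a b ∧ s.core C = .up a ∧ b ∉ s.queue C ∧ b ∈ s.done ∧
      e = some (.join C y)) := by
  by_cases hr : Ready s' C y
  · have := h.of_ready hr
    unfold Tok At
    unfold Ready at this
    grind [Ready]
  · have := h.of_up (C := C) (y := y)
    unfold Tok At at hy ⊢
    unfold Ready at hr
    grind

/-- A core that holds something inside `q` after a step already did so before the step, or has
just stolen it, or is about to start `q`. -/
theorem Step.of_tok_prefix (h : Step Pi prio s e s') {C : Fin p} {q y : Path} (hy : Tok s' C y)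
    (hq : q <+: y) :
    (∃ x, q <+: x ∧ Tok s C x) ∨ (∃ V, e = some (.steal C V y) ∧ y ∈ s.queue V) ∨
      (y = q ∧ Ready s' C q ∧ ((∃ x, q = x ++ [.seqR] ∧ s.core C = .up (x ++ [.seqL])) ∨
        ∀ x, q ≠ x ++ [.seqR])) := by
  rcases h.of_tok hy with h1 | h1 | ⟨x, d, rfl, h1, -, h2, -, h3⟩ | ⟨x, rfl, h1, -, h3⟩ |
    ⟨d, -, h1, -⟩ | ⟨a, b, hab, h1, -⟩
  · exact Or.inl ⟨y, hq, h1⟩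
  · exact Or.inr (Or.inl h1)
  · rcases prefix_concat.1 hq with rfl | hq
    · refine Or.inr (Or.inr ⟨rfl, h3, Or.inr fun x' hx' => ?_⟩)
      simp_all
    · exact Or.inl ⟨x, hq, Or.inl (Or.inl h1)⟩
  · rcases prefix_concat.1 hq with rfl | hq
    · exact Or.inr (Or.inr ⟨rfl, h3, Or.inl ⟨x, rfl, h1⟩⟩)
    · exact Or.inl ⟨_, hq.trans (List.prefix_append _ _), Or.inl (Or.inr h1)⟩
  · exact Or.inl ⟨_, hq.trans (List.prefix_append _ _), Or.inl (Or.inr h1)⟩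
  · obtain ⟨d, rfl, -⟩ := hab.concat
    exact Or.inl ⟨_, hq.trans (List.prefix_append _ _), Or.inl (Or.inr h1)⟩

theorem Step.of_done (h : Step Pi prio s e s') {q : Path} (hq : q ∈ s'.done) :
    q ∈ s.done ∨ ∃ C, s.core C = .up q ∧ (∀ y, At s' C y → ¬ q <+: y) ∧
      (∀ y ∈ s'.queue C, y ∈ s.queue C) ∧ ∀ C' y, C' ≠ C → Tok s' C' y → Tok s C' y := by
  unfold At Tok At
  cases h
  case resume C r ts hc hr =>
    have : ¬ r ++ [Dir.forkL] <+: r ++ [Dir.forkR] := by simp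
    simp only [Function.update_apply]
    grind
  case join C r a b hc hab hb hd =>
    have : ¬ a <+: r := by
      obtain ⟨d, rfl, -⟩ := hab.concat
      exact not_concat_prefix
    simp only [Function.update_apply]
    grind
  case wait C r a b hc hab hb hd =>
    rcases Set.mem_insert_iff.1 hq with rfl | hq
    · refine Or.inr ⟨C, hc, by simp, by simp, fun C' y hne => ?_⟩
      simp [Function.update_of_ne hne]
    · exact Or.inl hq
  all_goals
    simp only [Function.update_apply]
    grind

theorem Step.next (h : Step Pi prio s e s') {C : Fin p} {q : Path}
    (hc : s.core C = .up (q ++ [.seqL])) (hr : Ready s' C (q ++ [.seqR])) :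
    Ready s C (q ++ [.seqR]) ∨ s'.core C = .down (q ++ [.seqR]) ∧
      ∀ C', s'.queue C' = s.queue C' ∧ (C' ≠ C → s'.core C' = s.core C') := by
  unfold Ready at hr ⊢
  cases h <;> simp only [Function.update_apply] at hr ⊢ <;> grind

/-- Only one core gains tokens in a step; any other can merely lose a task to a thief. The antichain
invariant thereby reduces to pairs involving the acting core. -/
theorem Step.exists_acting (h : Step Pi prio s e s') :
    ∃ C, ∀ C' y, C' ≠ C → Tok s' C' y → Tok s C' y := by
  unfold Tok At
  cases h
  case newRound q h1 h2 h3 h4 =>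
    -- No token changes here, so any core serves; the queue head supplies one.
    obtain ⟨C, -⟩ := h3
    exact ⟨C, fun _ _ _ h => h⟩
  case leaf C _ _ _ _ => exact ⟨C, by simp only [Function.update_apply]; grind⟩
  case fork C _ _ _ _ _ _ _ => exact ⟨C, by simp only [Function.update_apply]; grind⟩
  case seq C _ _ _ _ _ => exact ⟨C, by simp only [Function.update_apply]; grind⟩
  case call C _ _ _ _ _ => exact ⟨C, by simp only [Function.update_apply]; grind⟩
  case seqNext C _ _ => exact ⟨C, by simp only [Function.update_apply]; grind⟩
  case seqEnd C _ _ => exact ⟨C, by simp only [Function.update_apply]; grind⟩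
  case callEnd C _ _ => exact ⟨C, by simp only [Function.update_apply]; grind⟩
  case resume C _ _ _ _ => exact ⟨C, by simp only [Function.update_apply]; grind⟩
  case join C _ _ _ _ _ _ _ => exact ⟨C, by simp only [Function.update_apply]; grind⟩
  case wait C _ _ _ _ _ _ _ => exact ⟨C, by simp only [Function.update_apply]; grind⟩
  case finish C _ => exact ⟨C, by simp only [Function.update_apply]; grind⟩
  case steal C _ _ _ _ _ _ => exact ⟨C, by simp only [Function.update_apply]; grind⟩

/-- Tokens do not vanish silently: one leaves its part only upward or sideways after completion, at
the end of the root, or by `wait`. In the last case the sibling is not done, so some other token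
must account for it. -/
theorem Step.forward (h : Step Pi prio s e s') {C : Fin p} {y : Path} (hy : Tok s C y) :
    (∃ C' y', Tok s' C' y' ∧ y <+: y') ∨
    (s.core C = .up y ∧ (y = [] ∨
      (∃ z d, y = z ++ [d] ∧ (∀ x b, Sibling x y b → y ∈ s'.done) ∧
        ∃ C' y', Tok s' C' y' ∧ z <+: y') ∨
      (∃ z b, Sibling z y b ∧ y ∈ s'.done ∧ b ∉ s.done ∧
        ∀ C' x, Tok s C' x → x ≠ y → Tok s' C' x))) := by
  have same : ∀ {C' : Fin p} {y : Path}, Tok s' C' y → ∃ C' y', Tok s' C' y' ∧ y <+: y' :=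
    fun h => ⟨_, _, h, List.prefix_rfl⟩
  have mem : y ∈ s.queue C → ∃ C' y', Tok s' C' y' ∧ y <+: y' := by
    intro hm
    suffices ∃ C', Ready s' C' y by
      obtain ⟨C', h'⟩ := this
      exact same (C' := C') (h'.elim (fun h => Or.inl (Or.inl h)) Or.inr)
    unfold Ready
    cases h <;> simp only [Function.update_apply]
    case resume C₁ r ts hc hr =>
      by_cases hC : C = C₁
      · exact ⟨C₁, by grind⟩
      · exact ⟨C, by grind⟩
    case steal C₁ V q ts hi hq hr =>
      by_cases hy : y = q
      · exact ⟨C₁, by grind⟩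
      · exact ⟨C, by grind⟩
    all_goals exact ⟨C, by grind⟩
  rcases hy with hy | hy
  swap
  · exact Or.inl (mem hy)
  by_cases hd : At s' C y
  · exact Or.inl (same (Or.inl hd))
  rcases hy with hy | hy
  · refine Or.inl ⟨C, ?_⟩
    unfold Tok
    unfold At at hd ⊢
    cases h
    case fork => exact ⟨y ++ [.forkL], by grind, List.prefix_append _ _⟩
    case seq => exact ⟨y ++ [.seqL], by grind, List.prefix_append _ _⟩
    case call => exact ⟨y ++ [.call], by grind, List.prefix_append _ _⟩
    all_goals
      simp only [Function.update_apply] at hd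
      grind
  · refine Or.inr ⟨hy, ?_⟩
    have nosib : ∀ {q : Path} {d : Dir}, d ≠ .forkL → d ≠ .forkR →
        ∀ x b, ¬ Sibling x (q ++ [d]) b := by
      intro q d h1 h2 x b hx
      obtain ⟨d', h3, h4⟩ := hx.concat
      simp_all
    cases h
    case seqNext C₁ q hc =>
      obtain rfl : C = C₁ := by by_contra hne; simp [At, hne, hy] at hd
      obtain rfl : y = q ++ [.seqL] := by simpa [hy] using hc
      exact Or.inr (Or.inl ⟨q, _, rfl, fun x b h => absurd h (nosib (by simp) (by simp) x b),
        C, q ++ [.seqR], Or.inl (Or.inl (by simp)), List.prefix_append _ _⟩)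
    case seqEnd C₁ q hc =>
      obtain rfl : C = C₁ := by by_contra hne; simp [At, hne, hy] at hd
      obtain rfl : y = q ++ [.seqR] := by simpa [hy] using hc
      exact Or.inr (Or.inl ⟨q, _, rfl, fun x b h => absurd h (nosib (by simp) (by simp) x b),
        C, q, Or.inl (Or.inr (by simp)), List.prefix_rfl⟩)
    case callEnd C₁ q hc =>
      obtain rfl : C = C₁ := by by_contra hne; simp [At, hne, hy] at hd
      obtain rfl : y = q ++ [.call] := by simpa [hy] using hc
      exact Or.inr (Or.inl ⟨q, _, rfl, fun x b h => absurd h (nosib (by simp) (by simp) x b),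
        C, q, Or.inl (Or.inr (by simp)), List.prefix_rfl⟩)
    case resume C₁ q ts hc hq =>
      obtain rfl : C = C₁ := by by_contra hne; simp [At, hne, hy] at hd
      obtain rfl : y = q ++ [.forkL] := by simpa [hy] using hc
      exact Or.inr (Or.inl ⟨q, _, rfl, fun x b h => by simp,
        C, q ++ [.forkR], Or.inl (Or.inl (by simp)), List.prefix_append _ _⟩)
    case join C₁ q a b hc hab hb hbd =>
      obtain rfl : C = C₁ := by by_contra hne; simp [At, hne, hy] at hd
      obtain rfl : y = a := by simpa [hy] using hc
      obtain ⟨d, hd', -⟩ := hab.concat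
      exact Or.inr (Or.inl ⟨q, d, hd', fun x b h => by simp,
        C, q, Or.inl (Or.inr (by simp)), List.prefix_rfl⟩)
    case wait C₁ q a b hc hab hb hbd =>
      obtain rfl : C = C₁ := by by_contra hne; simp [At, hne, hy] at hd
      obtain rfl : y = a := by simpa [hy] using hc
      refine Or.inr (Or.inr ⟨q, b, hab, by simp, hbd, fun C' x hx hne => ?_⟩)
      by_cases hC : C' = C
      · subst hC
        simp only [Tok, At, hy, Core.up.injEq, reduceCtorEq, false_or] at hx
        exact Or.inr (hx.resolve_left (Ne.symm hne))
      · simpa [Tok, At, hC] using hx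
    case finish C₁ hc =>
      obtain rfl : C = C₁ := by by_contra hne; simp [At, hne, hy] at hd
      left
      simpa [hy] using hc
    all_goals
      simp only [At, Function.update_apply] at hd
      grind

/-- The owner works at the bottom of the queue, thieves at the top. The alternative `s.core C =
.idle` admits a core robbing itself, which the invariants exclude. -/
theorem Step.of_queue (h : Step Pi prio s e s') (C : Fin p) :
    s'.queue C = s.queue C ∨
    (∃ q, s.core C = .down q ∧ s'.core C = .down (q ++ [.forkL]) ∧
      s'.queue C = s.queue C ++ [q ++ [.forkR]]) ∨
    (∃ q, s.core C = .up (q ++ [.forkL]) ∧ s'.core C = .down (q ++ [.forkR]) ∧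
      s.queue C = s'.queue C ++ [q ++ [.forkR]] ∧ q ++ [.forkL] ∈ s'.done) ∨
    (∃ y C', s.queue C = y :: s'.queue C ∧ e = some (.steal C' C y) ∧
      (s'.core C = s.core C ∨ s.core C = .idle)) := by
  cases h
  case steal C₁ V q ts hi hq hr =>
    by_cases hV : C = V
    · subst hV
      refine Or.inr (Or.inr (Or.inr ⟨q, C₁, by simp [hq], rfl, ?_⟩))
      by_cases hC : C = C₁
      · exact Or.inr (hC ▸ hi)
      · exact Or.inl (by simp [Function.update_of_ne hC])
    · exact Or.inl (by simp [Function.update_of_ne hV])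
  all_goals
    simp only [Function.update_apply]
    grind

theorem Step.done_subset (h : Step Pi prio s e s') : s.done ⊆ s'.done := by
  cases h <;> grind

variable {tr : List (Event p)} {C₀ : Fin p}

/-! ### The invariants of an execution -/

/-- The structural invariants of an execution. -/
structure Inv (Pi : Comp W) (tr : List (Event p)) (s : Config p) : Prop where
  root : Started tr [] ∨ ∃ C, s.core C = .down []
  valid_started : ∀ q, Started tr q → Pi.sub q ≠ none
  valid : ∀ C y, Tok s C y → Pi.sub y ≠ none
  fresh : ∀ C y, Ready s C y → ¬ Started tr y
  parent : ∀ C y, Tok s C y → ∀ x, x <+: y → x ≠ y → Started tr x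
  closed : ∀ q q', q <+: q' → Started tr q' → Started tr q
  up : ∀ C q, s.core C = .up q → Performed Pi tr q
  done : ∀ q ∈ s.done, Over Pi tr s q
  before : ∀ q, (Started tr (q ++ [.seqR]) ∨ ∃ C y, Tok s C y ∧ q ++ [.seqR] <+: y) →
    Over Pi tr s (q ++ [.seqL])
  cross : ∀ C C' x y, Tok s C x → Tok s C' y → x <+: y → C = C'
  shape : ∀ C, ∀ y ∈ s.queue C, ∃ r, y = r ++ [.forkR]
  sorted : ∀ C, (s.queue C).Pairwise
    (fun y y' => ∃ r, y = r ++ [.forkR] ∧ r ++ [.forkL] <+: y')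
  chain : ∀ C r, r ++ [.forkR] ∈ s.queue C → ∃ y, At s C y ∧ r ++ [.forkL] <+: y ∧
    ∀ z, r ++ [.forkL] <+: z → (z ++ [.forkL] <+: y → z ++ [.forkR] ∈ s.queue C) ∧
      (z ++ [.forkR] <+: y → z ++ [.forkL] ∈ s.done)
  progress : ∀ q, Started tr q → Performed Pi tr q ∨ ∃ C y, Tok s C y ∧ q <+: y
  branch : ∀ q a b, Started tr q → Sibling q a b → Pi.sub a ≠ none →
    a ∈ s.done ∨ ∃ C y, Tok s C y ∧ a <+: y
  unique : ∀ C C' q, Event.start C q ∈ tr → Event.start C' q ∈ tr → C = C'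
  joined : ∀ C q, Event.join C q ∈ tr → Started tr q

namespace Inv

variable (hI : Inv Pi tr s)
include hI

/-- The core is inside the left sibling of each task on its queue. -/
theorem not_mem_queue_of_at {C : Fin p} {x y : Path} (hx : At s C x) (hy : y ∈ s.queue C) :
    ¬ x <+: y ∧ ¬ y <+: x := by
  obtain ⟨r, rfl⟩ := hI.shape C y hy
  obtain ⟨z, hz, hrz, -⟩ := hI.chain C r hy
  obtain rfl : x = z := by
    unfold At at hx hz
    grind
  constructor
  · intro h
    have := hrz.trans h
    simp at this
  · intro h
    have := eq_of_concat_prefix hrz h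
    simp at this

/-- Different tokens lie in incomparable places. -/
theorem solo {C C' : Fin p} {x y : Path} (hx : Tok s C x) (hy : Tok s C' y) (h : x <+: y) :
    C = C' ∧ x = y := by
  obtain rfl := hI.cross C C' x y hx hy h
  refine ⟨rfl, ?_⟩
  rcases hx with hx | hx <;> rcases hy with hy | hy
  · unfold At at hx hy
    grind
  · exact absurd h (hI.not_mem_queue_of_at hx hy).1
  · exact absurd h (hI.not_mem_queue_of_at hy hx).2
  · by_contra hne
    have hs := hI.sorted C
    rw [List.pairwise_iff_getElem] at hs
    obtain ⟨i, hi, rfl⟩ := List.getElem_of_mem hx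
    obtain ⟨j, hj, rfl⟩ := List.getElem_of_mem hy
    rcases lt_trichotomy i j with hij | rfl | hij
    · obtain ⟨r, h1, h2⟩ := hs i j hi hj hij
      rw [h1] at h
      have := eq_of_concat_prefix h h2
      simp at this
    · exact hne rfl
    · obtain ⟨r, h1, h2⟩ := hs j i hj hi hij
      have := h2.trans h
      rw [h1] at this
      simp at this

theorem queue_eq_nil_of_idle {C : Fin p} (h : s.core C = .idle) : s.queue C = [] := by
  rw [List.eq_nil_iff_forall_not_mem]
  intro y hy
  obtain ⟨r, rfl⟩ := hI.shape C y hy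
  obtain ⟨z, hz, -⟩ := hI.chain C r hy
  simp [At, h] at hz

/-- A newly ready child has an unstarted parent, except for the second half of a sequence: had that
been started before, `before` would declare the first half left, yet the core is still there. A part
started in this very step is excluded by `solo`. -/
theorem fresh_step (h : Step Pi prio s e s') {C : Fin p} {y : Path} (hy : Ready s' C y) :
    ¬ Started (tr ++ e.toList) y := by
  rw [started_append]
  rintro (hs | ⟨C₀, rfl⟩)
  · rcases h.of_ready hy with (⟨h1, -⟩ | h1) | ⟨V, -, h1⟩ | ⟨q, d, rfl, h1, -⟩ | ⟨q, rfl, h1, -⟩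
    · exact hI.fresh C y h1 hs
    · exact hI.fresh C y (Or.inr h1) hs
    · exact hI.fresh V y (Or.inr h1) hs
    · exact hI.fresh C q (Or.inl h1) (hI.closed _ _ (List.prefix_append _ _) hs)
    · exact (hI.before q (Or.inl hs)).2.2 C _ (Or.inl (Or.inr h1)) List.prefix_rfl
  · have h0 := h.core_of_start rfl
    have h0' : At s C₀ y := Or.inl h0
    rcases h.of_ready hy with (⟨h1, h2⟩ | h1) | ⟨V, h1, -⟩ | ⟨q, d, rfl, -, h1, -⟩ |
      ⟨q, rfl, -, h1⟩
    · have h1' : Tok s C y := h1.elim (fun h => Or.inl (Or.inl h)) Or.inr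
      obtain ⟨rfl, -⟩ := hI.solo (Or.inl h0') h1' List.prefix_rfl
      exact h2 rfl
    · obtain ⟨rfl, -⟩ := hI.solo (Or.inl h0') (Or.inr h1) List.prefix_rfl
      exact (hI.not_mem_queue_of_at h0' h1).1 List.prefix_rfl
    · simp at h1
    · simp at h1
    · simp at h1

/-- Re-entering the part would require being about to start it again, against freshness. -/
theorem over_step (h : Step Pi prio s e s') {q : Path} (hq : Over Pi tr s q) :
    Over Pi (tr ++ e.toList) s' q := by
  refine ⟨hq.1.mono _, hq.2.1.mono _, fun C y hy hqy => ?_⟩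
  rcases h.of_tok_prefix hy hqy with ⟨x, hx, hx'⟩ | ⟨V, -, hV⟩ | ⟨rfl, hr, -⟩
  · exact hq.2.2 C x hx' hx
  · exact hq.2.2 V y (Or.inr hV) hqy
  · exact hI.fresh_step h hr (hq.1.mono _)

theorem started_of_up {C : Fin p} {q : Path} (h : s.core C = .up q) : Started tr q := by
  obtain ⟨y, hy⟩ := Option.ne_none_iff_exists'.1 (hI.valid C q (Or.inl (Or.inr h)))
  exact (hI.up C q h q y List.prefix_rfl hy).1

theorem started_of_at_concat {C : Fin p} {q : Path} {d : Dir} (h : At s C (q ++ [d])) :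
    Started tr q :=
  hI.parent C _ (Or.inl h) q (List.prefix_append _ _) (by simp)

theorem valid_step (h : Step Pi prio s e s') {C : Fin p} {y : Path} (hy : Tok s' C y) :
    Pi.sub y ≠ none := by
  rcases h.of_tok hy with h1 | ⟨V, -, h1⟩ | ⟨q, d, -, -, -, -, h1, -⟩ | ⟨q, rfl, h1, -⟩ |
    ⟨d, -, h1, -⟩ | ⟨a, b, hab, h1, -⟩
  · exact hI.valid C y h1
  · exact hI.valid V y (Or.inr h1)
  · exact h1
  · have hv := hI.valid C _ (Or.inl (Or.inr h1))
    obtain ⟨x, hx⟩ := Option.ne_none_iff_exists'.1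
      (Comp.sub_ne_none_of_prefix (List.prefix_append _ _) hv)
    rcases sub_children hx hv with ⟨a, b, rfl, -⟩ | ⟨_, _, _, _, -, h⟩ | ⟨_, _, -, h⟩
    · rw [Comp.sub_concat _ hx]
      simp [Comp.sub, Comp.sub_nil]
    · simp at h
    · simp at h
  · exact Comp.sub_ne_none_of_prefix (List.prefix_append _ _) (hI.valid C _ (Or.inl (Or.inr h1)))
  · obtain ⟨_, _, _, _, h2⟩ := (sub_sibling hab (hI.valid C _ (Or.inl (Or.inr h1)))).2
    simp [h2]

theorem parent_step (h : Step Pi prio s e s') {C : Fin p} {y : Path} (hy : Tok s' C y) {x : Path}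
    (hx : x <+: y) (hne : x ≠ y) : Started (tr ++ e.toList) x := by
  rcases h.of_tok hy with h1 | ⟨V, -, h1⟩ | ⟨q, d, rfl, h1, h2, -⟩ | ⟨q, rfl, h1, -⟩ |
    ⟨d, -, h1, -⟩ | ⟨a, b, hab, h1, -⟩
  · exact (hI.parent C y h1 x hx hne).mono _
  · exact (hI.parent V y (Or.inr h1) x hx hne).mono _
  · have hx := (prefix_concat.1 hx).resolve_left hne
    by_cases hq : x = q
    · subst hq
      rw [started_append]
      exact Or.inr ⟨C, h2⟩
    · exact (hI.parent C q (Or.inl (Or.inl h1)) x hx hq).mono _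
  · have hx := (prefix_concat.1 hx).resolve_left hne
    refine (hI.parent C _ (Or.inl (Or.inr h1)) x (hx.trans (List.prefix_append _ _)) ?_).mono _
    rintro rfl
    exact not_concat_prefix hx
  · refine (hI.closed x y hx (hI.started_of_at_concat (Or.inr h1))).mono _
  · obtain ⟨d, rfl, -⟩ := hab.concat
    refine (hI.closed x y hx (hI.started_of_at_concat (Or.inr h1))).mono _

theorem closed_step (h : Step Pi prio s e s') {q q' : Path} (hq : q <+: q')
    (hs : Started (tr ++ e.toList) q') : Started (tr ++ e.toList) q := by
  rcases started_append.1 hs with hs | ⟨C, he⟩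
  · exact (hI.closed q q' hq hs).mono _
  · by_cases hne : q = q'
    · rwa [hne]
    · exact (hI.parent C q' (Or.inl (Or.inl (h.core_of_start he))) q hq hne).mono _

theorem up_step (h : Step Pi prio s e s') {C : Fin p} {y : Path} (hy : s'.core C = .up y) :
    Performed Pi (tr ++ e.toList) y := by
  rcases h.of_up hy with h1 | ⟨h1, h2, a, h3⟩ | ⟨d, hd, h1, -⟩ | ⟨a, b, hab, h1, -, h2, h3⟩
  · exact (hI.up C y h1).mono _
  · refine performed_of_children (started_append.2 (Or.inr ⟨C, h2⟩)) (by simp [h3]) ?_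
    intro d hd
    have := sub_children h3 hd
    simp at this
  · have hs := hI.started_of_at_concat (Or.inr h1)
    obtain ⟨x, hx⟩ := Option.ne_none_iff_exists'.1 (hI.valid_started y hs)
    have hv := hI.valid C _ (Or.inl (Or.inr h1))
    have hk := sub_children hx hv
    refine Performed.mono (performed_of_children hs ?_ ?_) _
    · intro hd' l r tl hf
      obtain rfl : x = _ := Option.some.inj (hx.symm.trans hf)
      rcases hd with rfl | rfl <;> simp at hk
    · intro d' hd'
      have hk' := sub_children hx hd'
      rcases hd with rfl | rfl
      · obtain rfl | rfl : d' = .seqL ∨ d' = .seqR := by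
          rcases hk with ⟨_, _, rfl, -⟩ | ⟨_, _, _, _, -, h⟩ | ⟨_, _, -, h⟩ <;> simp_all
        · exact (hI.before y (Or.inr ⟨C, _, Or.inl (Or.inr h1), List.prefix_rfl⟩)).2.1
        · exact hI.up C _ h1
      · obtain rfl : d' = .call := by
          rcases hk with ⟨_, _, rfl, h⟩ | ⟨_, _, _, _, -, h⟩ | ⟨_, _, rfl, -⟩ <;> simp_all
        exact hI.up C _ h1
  · obtain ⟨hv, hd, l, r, tl, hf⟩ := sub_sibling hab (hI.valid C _ (Or.inl (Or.inr h1)))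
    refine performed_of_children (Started.mono ?_ _) ?_ ?_
    · obtain ⟨d, rfl, -⟩ := hab.concat
      exact hI.started_of_at_concat (Or.inr h1)
    · intro _ _ _ _ _
      exact ⟨C, by simp [h3]⟩
    · intro d hd
      have hk := sub_children hf hd
      have ha := hI.up C _ h1
      have hb := (hI.done b h2).2.1
      refine Performed.mono ?_ _
      rcases hab with ⟨rfl, rfl⟩ | ⟨rfl, rfl⟩ <;> simp at hk <;> rcases hk with rfl | rfl <;>
        assumption

theorem done_step (h : Step Pi prio s e s') {q : Path} (hq : q ∈ s'.done) :
    Over Pi (tr ++ e.toList) s' q := by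
  rcases h.of_done hq with hq | ⟨C, h1, h2, h3, h4⟩
  · exact hI.over_step h (hI.done q hq)
  · have ht : Tok s C q := Or.inl (Or.inr h1)
    refine ⟨(hI.started_of_up h1).mono _, (hI.up C q h1).mono _, fun C' y hy hqy => ?_⟩
    by_cases hC : C' = C
    · subst hC
      rcases hy with hy | hy
      · exact h2 y hy hqy
      · exact (hI.not_mem_queue_of_at (Or.inr h1) (h3 y hy)).1 hqy
    · exact hC (hI.solo ht (h4 C' y hC hy) hqy).1.symm

theorem before_step (h : Step Pi prio s e s') {q : Path}
    (hq : Started (tr ++ e.toList) (q ++ [.seqR]) ∨ ∃ C y, Tok s' C y ∧ q ++ [.seqR] <+: y) :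
    Over Pi (tr ++ e.toList) s' (q ++ [.seqL]) := by
  have old : ∀ C y, Tok s C y → q ++ [.seqR] <+: y →
      Over Pi (tr ++ e.toList) s' (q ++ [.seqL]) :=
    fun C y h1 h2 => hI.over_step h (hI.before q (Or.inr ⟨C, y, h1, h2⟩))
  rcases hq with hq | ⟨C, y, hy, hqy⟩
  · rcases started_append.1 hq with hq | ⟨C, he⟩
    · exact hI.over_step h (hI.before q (Or.inl hq))
    · exact old C _ (Or.inl (Or.inl (h.core_of_start he))) List.prefix_rfl
  · rcases h.of_tok_prefix hy hqy with ⟨x, hx, hx'⟩ | ⟨V, -, hV⟩ | ⟨rfl, hr, ⟨x, hx, h1⟩ | hx⟩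
    · exact old C x hx' hx
    · exact old V y (Or.inr hV) hqy
    · obtain rfl : q = x := by simpa using hx
      rcases h.next h1 hr with h2 | ⟨h2, h3⟩
      · exact old C _ (h2.elim (fun h => Or.inl (Or.inl h)) Or.inr) List.prefix_rfl
      · have ht : Tok s C (q ++ [.seqL]) := Or.inl (Or.inr h1)
        refine ⟨(hI.started_of_up h1).mono _, (hI.up C _ h1).mono _, fun C' z hz hqz => ?_⟩
        -- The token at the first half has become the one at the second half; every other token is
        -- old, and `solo` keeps it out of the first half.
        have hz' : Tok s C' z ∧ ¬ (C' = C ∧ z = q ++ [.seqL]) ∨ z = q ++ [.seqR] := by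
          by_cases hC : C' = C
          · subst hC
            rcases hz with hz | hz
            · simp only [At, h2, Core.down.injEq, reduceCtorEq, or_false] at hz
              exact Or.inr hz.symm
            · rw [(h3 C').1] at hz
              exact absurd hqz (hI.not_mem_queue_of_at (Or.inr h1) hz).1
          · refine Or.inl ⟨?_, fun h => hC h.1⟩
            simpa only [Tok, At, (h3 C').1, (h3 C').2 hC] using hz
        rcases hz' with ⟨hz', hne⟩ | rfl
        · obtain ⟨rfl, rfl⟩ := hI.solo ht hz' hqz
          exact hne ⟨rfl, rfl⟩
        · simp at hqz
    · exact absurd rfl (hx q)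

/-- An idle core has an empty queue, so it cannot rob itself. The victim keeps no copy: its
remaining tasks lie in the left sibling of the stolen one. -/
theorem not_tok_of_steal (h : Step Pi prio s e s') {C V : Fin p} {y : Path}
    (he : e = some (.steal C V y)) : V ≠ C ∧ ¬ Tok s' V y := by
  cases h <;> simp only [reduceCtorEq, Option.some.injEq, Event.steal.injEq] at he
  rename_i C' V' y' ts hi hq hr
  obtain ⟨rfl, rfl, rfl⟩ := he
  have hne : V' ≠ C' := by
    rintro rfl
    rw [hI.queue_eq_nil_of_idle hi] at hq
    simp at hq
  refine ⟨hne, ?_⟩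
  simp only [Tok, At, Function.update_of_ne hne, Function.update_self]
  rintro (h | h)
  · exact (hI.not_mem_queue_of_at (x := y') (y := y') h (by simp [hq])).1 List.prefix_rfl
  · have := hI.sorted V'
    rw [hq, List.pairwise_cons] at this
    obtain ⟨r, h1, h2⟩ := this.1 y' h
    rw [h1] at h2
    simp at h2

theorem cross_step (h : Step Pi prio s e s') {C C' : Fin p} {x y : Path} (hx : Tok s' C x)
    (hy : Tok s' C' y) (hxy : x <+: y) : C = C' := by
  obtain ⟨C₀, h0⟩ := h.exists_acting
  -- Only the acting core `C₀` needs checking. When it moves up to a parent, the other child must be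
  -- free of tokens: `before` ensures this for a first half, `done` for the sibling at a join.
  have key : ∀ B x y, B ≠ C₀ → Tok s' C₀ x → Tok s' B y → ¬ x <+: y ∧ ¬ y <+: x := by
    intro B x y hB hx hy'
    have hy := h0 B y hB hy'
    have ascend : ∀ d, s.core C₀ = .up (x ++ [d]) → ¬ x ++ [d] <+: y ∧ ¬ y <+: x := by
      intro d hd
      have ht : Tok s C₀ (x ++ [d]) := Or.inl (Or.inr hd)
      exact ⟨fun h => hB (hI.solo ht hy h).1.symm,
        fun h => hB (hI.solo hy ht (h.trans (List.prefix_append _ _))).1⟩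
    have hv := hI.valid B y hy
    rcases h.of_tok hx with h1 | ⟨V, he, h1⟩ | ⟨q, d, rfl, h1, -⟩ | ⟨q, rfl, h1, -, h2⟩ |
      ⟨d, hd, h1, -⟩ | ⟨a, b, hab, h1, -, h2, -⟩
    · exact ⟨fun h => hB (hI.solo h1 hy h).1.symm, fun h => hB (hI.solo hy h1 h).1⟩
    · have hn := (hI.not_tok_of_steal h he).2
      constructor
      · intro h
        obtain ⟨rfl, rfl⟩ := hI.solo (Or.inr h1) hy h
        exact hn hy'
      · intro h
        obtain ⟨rfl, rfl⟩ := hI.solo hy (Or.inr h1) h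
        exact hn hy'
    · have ht : Tok s C₀ q := Or.inl (Or.inl h1)
      have hn : ¬ q <+: y := fun h => hB (hI.solo ht hy h).1.symm
      refine ⟨fun h => hn (prefix_of_concat_prefix h), fun h => ?_⟩
      rcases prefix_concat.1 h with rfl | h
      · exact hn (List.prefix_append _ _)
      · exact hB (hI.solo hy ht h).1
    · have ht : Tok s C₀ (q ++ [.seqL]) := Or.inl (Or.inr h1)
      have hn : ¬ q ++ [.seqR] <+: y := fun h =>
        (hI.before q (Or.inr ⟨B, y, hy, h⟩)).2.2 C₀ _ ht List.prefix_rfl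
      refine ⟨hn, fun h => ?_⟩
      rcases prefix_concat.1 h with rfl | h
      · exact hn List.prefix_rfl
      · exact hB (hI.solo hy ht (h.trans (List.prefix_append _ _))).1
    · obtain ⟨h2, h3⟩ := ascend d h1
      refine ⟨fun h => ?_, h3⟩
      have hv' := hI.valid C₀ _ (Or.inl (Or.inr h1))
      obtain ⟨z, hz⟩ := Option.ne_none_iff_exists'.1
        (Comp.sub_ne_none_of_prefix (List.prefix_append _ _) hv')
      have hk := sub_children hz hv'
      rcases prefix_cases h with rfl | ⟨d', hd'⟩
      · exact h3 List.prefix_rfl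
      · have hk' := sub_children hz (Comp.sub_ne_none_of_prefix hd' hv)
        have hdd : d' ≠ d := by
          rintro rfl
          exact h2 hd'
        rcases hd with rfl | rfl
        · obtain rfl : d' = .seqL := by
            rcases hk with ⟨_, _, rfl, -⟩ | ⟨_, _, _, _, -, h⟩ | ⟨_, _, -, h⟩ <;> simp_all
          exact (hI.before x (Or.inr ⟨C₀, _, Or.inl (Or.inr h1), List.prefix_rfl⟩)).2.2 B y hy hd'
        · rcases hk with ⟨_, _, rfl, h⟩ | ⟨_, _, _, _, -, h⟩ | ⟨_, _, rfl, -⟩ <;> simp_all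
    · obtain ⟨hvb, hd, l, r, tl, hf⟩ := sub_sibling hab (hI.valid C₀ _ (Or.inl (Or.inr h1)))
      have hb := (hI.done b h2).2.2 B y hy
      have hab' := hab
      obtain ⟨d, rfl, -⟩ := hab'.concat
      obtain ⟨h2, h3⟩ := ascend d h1
      refine ⟨fun h => ?_, h3⟩
      rcases prefix_cases h with rfl | ⟨d', hd'⟩
      · exact h3 List.prefix_rfl
      · have hk' := sub_children hf (Comp.sub_ne_none_of_prefix hd' hv)
        simp only [reduceCtorEq, false_and, exists_false, Comp.fork.injEq, exists_and_right,
          false_or, or_false] at hk'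
        rcases hab with ⟨ha, rfl⟩ | ⟨ha, rfl⟩ <;> rcases hk'.2 with rfl | rfl <;> simp_all
  by_contra hne
  by_cases h1 : C = C₀
  · subst h1
    exact (key C' x y (Ne.symm hne) hx hy).1 hxy
  · by_cases h2 : C' = C₀
    · subst h2
      exact (key C y x hne hy hx).2 hxy
    · exact hne (hI.cross C C' x y (h0 C x h1 hx) (h0 C' y h2 hy) hxy)

end Inv

-- Queue structure and conservation of unfinished work

theorem At.unique {C : Fin p} {x y : Path} (hx : At s C x) (hy : At s C y) : x = y := by
  unfold At at hx hy
  grind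

theorem Step.of_core (h : Step Pi prio s e s') (C : Fin p) :
    s'.core C = s.core C ∨
    (∃ q, s.core C = .down q ∧ s'.core C = .up q) ∨
    (∃ q, s.core C = .down q ∧ s'.queue C = s.queue C ++ [q ++ [.forkR]]) ∨
    (∃ q d, s.core C = .down q ∧ s'.core C = .down (q ++ [d]) ∧ d ≠ .forkL ∧ d ≠ .forkR) ∨
    (∃ q, s.core C = .up (q ++ [.seqL]) ∧ s'.core C = .down (q ++ [.seqR])) ∨
    (∃ q d, s.core C = .up (q ++ [d]) ∧ s'.core C = .up q ∧ (d = .seqR ∨ d = .call)) ∨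
    (∃ q, s.core C = .up (q ++ [.forkL]) ∧ s.queue C = s'.queue C ++ [q ++ [.forkR]]) ∨
    (∃ q a b, s.core C = .up a ∧ Sibling q a b ∧ b ∉ s.queue C ∧
      (s'.core C = .up q ∨ s'.core C = .idle ∧ b ∉ s.done)) ∨
    s.core C = .up [] ∨ s.core C = .idle := by
  by_cases hc : s'.core C = s.core C
  · exact Or.inl hc
  · refine Or.inr ?_
    cases h <;> simp only [Function.update_apply] at hc ⊢ <;> grind

namespace Inv

variable (hI : Inv Pi tr s)
include hI

theorem shape_step (h : Step Pi prio s e s') {C : Fin p} {y : Path} (hy : y ∈ s'.queue C) :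
    ∃ r, y = r ++ [.forkR] := by
  have := hI.shape C y
  rcases h.of_queue C with h1 | ⟨q, -, -, h1⟩ | ⟨q, -, -, h1, -⟩ | ⟨z, C', h1, -⟩
  · exact this (h1 ▸ hy)
  · rw [h1] at hy
    rcases List.mem_append.1 hy with hy | hy
    · exact this hy
    · exact ⟨q, by simpa using hy⟩
  · exact this (by simp [h1, hy])
  · exact this (by simp [h1, hy])

theorem sorted_step (h : Step Pi prio s e s') (C : Fin p) :
    (s'.queue C).Pairwise (fun y y' => ∃ r, y = r ++ [.forkR] ∧ r ++ [.forkL] <+: y') := by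
  have hs := hI.sorted C
  rcases h.of_queue C with h1 | ⟨q, h2, -, h1⟩ | ⟨q, -, -, h1, -⟩ | ⟨z, C', h1, -⟩
  · rwa [h1]
  · rw [h1, List.pairwise_append]
    refine ⟨hs, by simp, ?_⟩
    intro y hy y' hy'
    obtain rfl : y' = q ++ [.forkR] := by simpa using hy'
    obtain ⟨r, rfl⟩ := hI.shape C y hy
    obtain ⟨x, hx, hrx, -⟩ := hI.chain C r hy
    obtain rfl : x = q := hx.unique (Or.inl h2)
    exact ⟨r, rfl, hrx.trans (List.prefix_append _ _)⟩
  · rw [h1, List.pairwise_append] at hs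
    exact hs.1
  · rw [h1, List.pairwise_cons] at hs
    exact hs.2

/-- Below a pending fork, each left turn on the core's path has its sibling on the queue, and each
right turn has its left sibling done. So a core cannot get stuck at a join, and become idle, while
it still has queued tasks. -/
theorem chain_step (h : Step Pi prio s e s') {C : Fin p} {r : Path}
    (hr : r ++ [.forkR] ∈ s'.queue C) :
    ∃ y, At s' C y ∧ r ++ [.forkL] <+: y ∧
      ∀ z, r ++ [.forkL] <+: z → (z ++ [.forkL] <+: y → z ++ [.forkR] ∈ s'.queue C) ∧
        (z ++ [.forkR] <+: y → z ++ [.forkL] ∈ s'.done) := by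
  have hdone := h.done_subset
  rcases h.of_queue C with h1 | ⟨q, h1, h2, h3⟩ | ⟨q, h1, h2, h3, h4⟩ | ⟨y, C', h1, h2, h3⟩
  · rw [h1] at hr ⊢
    obtain ⟨y, hy, hry, hz⟩ := hI.chain C r hr
    -- Covers a core leaving `q ++ [d]` for a position at or below `q` without entering a further
    -- fork branch; it stays inside `r ++ [.forkL]` because it did not just complete that branch.
    have move : ∀ {q y' d}, y = q ++ [d] → At s' C y' → q <+: y' → r ++ [.forkL] ≠ q ++ [d] →
        (∀ z : Path, ∀ d : Dir, d = .forkL ∨ d = .forkR → z ++ [d] <+: y' → z ++ [d] <+: q) →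
        ∃ y, At s' C y ∧ r ++ [.forkL] <+: y ∧
          ∀ z, r ++ [.forkL] <+: z → (z ++ [.forkL] <+: y → z ++ [.forkR] ∈ s.queue C) ∧
            (z ++ [.forkR] <+: y → z ++ [.forkL] ∈ s'.done) := by
      rintro q y' d rfl h2 h3 h4 h5
      refine ⟨y', h2, ((prefix_concat.1 hry).resolve_left h4).trans h3, fun z hrz => ⟨?_, ?_⟩⟩
      · exact fun h6 => (hz z hrz).1 ((h5 z _ (by simp) h6).trans (List.prefix_append _ _))
      · exact fun h6 => hdone ((hz z hrz).2
          ((h5 z _ (by simp) h6).trans (List.prefix_append _ _)))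
    rcases h.of_core C with h2 | ⟨q, h2, h3⟩ | ⟨q, -, h2⟩ | ⟨q, d, h2, h3, h4, h5⟩ | ⟨q, h2, h3⟩ |
      ⟨q, d, h2, h3, h4⟩ | ⟨q, -, h2⟩ | ⟨q, a, b, h2, hab, h3, h4⟩ | h2 | h2
    · exact ⟨y, by simpa only [At, h2] using hy, hry,
        fun z hrz => ⟨(hz z hrz).1, fun h3 => hdone ((hz z hrz).2 h3)⟩⟩
    · obtain rfl : y = q := hy.unique (Or.inl h2)
      exact ⟨y, Or.inr h3, hry,
        fun z hrz => ⟨(hz z hrz).1, fun h3 => hdone ((hz z hrz).2 h3)⟩⟩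
    · rw [h1] at h2
      simp at h2
    · obtain rfl : y = q := hy.unique (Or.inl h2)
      have down : ∀ z d', d' = .forkL ∨ d' = .forkR → z ++ [d'] <+: y ++ [d] →
          z ++ [d'] <+: y := by
        intro z d' hd' h6
        refine (prefix_concat.1 h6).resolve_left fun h7 => ?_
        obtain ⟨-, h8⟩ := List.append_inj' h7 rfl
        simp only [List.cons.injEq, and_true] at h8
        rcases hd' with rfl | rfl
        · exact h4 h8.symm
        · exact h5 h8.symm
      exact ⟨_, Or.inl h3, hry.trans (List.prefix_append _ _), fun z hrz =>
        ⟨fun h6 => (hz z hrz).1 (down z _ (by simp) h6),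
          fun h6 => hdone ((hz z hrz).2 (down z _ (by simp) h6))⟩⟩
    · refine move (hy.unique (Or.inr h2)) (Or.inl h3) (List.prefix_append _ _) (by simp) ?_
      intro z d hd hzd
      refine (prefix_concat.1 hzd).resolve_left ?_
      rcases hd with rfl | rfl <;> simp
    · refine move (hy.unique (Or.inr h2)) (Or.inr h3) List.prefix_rfl ?_ fun z d _ h => h
      rcases h4 with rfl | rfl <;> simp
    · rw [h1] at h2
      simp at h2
    · obtain rfl : y = a := hy.unique (Or.inr h2)
      obtain ⟨d, rfl, hd⟩ := hab.concat
      have hne : r ++ [.forkL] ≠ q ++ [d] := by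
        intro h5
        obtain ⟨rfl, h6⟩ := List.append_inj' h5 rfl
        simp only [List.cons.injEq, and_true] at h6
        subst h6
        rcases hab with ⟨-, rfl⟩ | ⟨h7, -⟩
        · exact h3 hr
        · simp at h7
      rcases h4 with h4 | ⟨-, h4⟩
      · exact move rfl (Or.inr h4) List.prefix_rfl hne fun z d _ h => h
      -- Waiting is impossible here: by the chain, the sibling is either on the queue or done.
      · have hrq := (prefix_concat.1 hry).resolve_left hne
        rcases hab with ⟨h7, rfl⟩ | ⟨h7, rfl⟩
        · exact absurd ((hz q hrq).1 (h7 ▸ List.prefix_rfl)) h3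
        · exact absurd ((hz q hrq).2 (h7 ▸ List.prefix_rfl)) h4
    · obtain rfl : y = [] := hy.unique (Or.inr h2)
      simp at hry
    · rw [hI.queue_eq_nil_of_idle h2] at hr
      simp at hr
  · refine ⟨_, Or.inl h2, ?_⟩
    rw [h3] at hr ⊢
    rcases List.mem_append.1 hr with hr | hr
    · obtain ⟨y, hy, hry, hz⟩ := hI.chain C r hr
      obtain rfl : y = q := hy.unique (Or.inl h1)
      refine ⟨hry.trans (List.prefix_append _ _), fun z hrz => ⟨fun h6 => ?_, fun h6 => ?_⟩⟩
      · rcases prefix_concat.1 h6 with h7 | h7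
        · obtain ⟨rfl, -⟩ := List.append_inj' h7 rfl
          simp
        · simp [(hz z hrz).1 h7]
      · rcases prefix_concat.1 h6 with h7 | h7
        · simp at h7
        · exact hdone ((hz z hrz).2 h7)
    · obtain rfl : r = q := by simpa using hr
      refine ⟨List.prefix_rfl, fun z hrz => ⟨fun h6 => ?_, fun h6 => ?_⟩⟩
      · exact absurd (h6.trans hrz) not_concat_prefix
      · exact absurd (h6.trans hrz) not_concat_prefix
  · have hr' : r ++ [.forkR] ∈ s.queue C := by simp [h3, hr]
    obtain ⟨y, hy, hry, hz⟩ := hI.chain C r hr'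
    obtain rfl : y = q ++ [.forkL] := hy.unique (Or.inr h1)
    have hs := hI.sorted C
    rw [h3, List.pairwise_append] at hs
    -- By sortedness, the task popped from the bottom lies in the left sibling of every task that
    -- remains.
    obtain ⟨r', h5, h6⟩ := hs.2.2 _ hr (q ++ [.forkR]) (by simp)
    obtain rfl : r = r' := by simpa using h5
    have hrq := (prefix_concat.1 h6).resolve_left (by simp)
    refine ⟨_, Or.inl h2, h6, fun z hrz => ⟨fun h7 => ?_, fun h7 => ?_⟩⟩
    · have h8 := (prefix_concat.1 h7).resolve_left (by simp)
      have h9 := (hz z hrz).1 (h8.trans (List.prefix_append _ _))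
      rw [h3] at h9
      rcases List.mem_append.1 h9 with h9 | h9
      · exact h9
      · obtain rfl : z = q := by simpa using h9
        exact absurd h8 not_concat_prefix
    · rcases prefix_concat.1 h7 with h8 | h8
      · obtain rfl : z = q := by simpa using h8
        exact h4
      · exact hdone ((hz z hrz).2 (h8.trans (List.prefix_append _ _)))
  · have hr' : r ++ [.forkR] ∈ s.queue C := by simp [h1, hr]
    obtain ⟨x, hx, hrx, hz⟩ := hI.chain C r hr'
    have hs := hI.sorted C
    rw [h1, List.pairwise_cons] at hs
    obtain ⟨r', rfl, h5⟩ := hs.1 _ hr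
    have hrr := (prefix_concat.1 h5).resolve_left (by simp)
    refine ⟨x, ?_, hrx, fun z hrz => ⟨fun h7 => ?_, fun h7 => hdone ((hz z hrz).2 h7)⟩⟩
    · rcases h3 with h3 | h3
      · simpa only [At, h3] using hx
      · simp [At, h3] at hx
    · have h8 := (hz z hrz).1 h7
      rw [h1] at h8
      rcases List.mem_cons.1 h8 with h8 | h8
      · obtain rfl : z = r' := by simpa using h8
        -- The stolen head branches off above `r`, so it is not the sibling of a turn below `r`.
        exact absurd (hrr.trans ((List.prefix_append _ _).trans hrz)) not_concat_prefix
      · exact h8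

/-- The last token to leave `q` does so on completing it. A core that waits strictly inside `q`
leaves behind an unfinished sibling, also inside `q`, where `branch` provides another token. -/
theorem forward (h : Step Pi prio s e s') {C : Fin p} {q y : Path} (hy : Tok s C y)
    (hq : q <+: y) :
    (∃ C' y', Tok s' C' y' ∧ q <+: y') ∨
      (Performed Pi tr q ∧ ∀ x b, Sibling x q b → q ∈ s'.done) := by
  rcases h.forward hy with ⟨C', y', h1, h2⟩ | ⟨h1, h2⟩
  · exact Or.inl ⟨C', y', h1, hq.trans h2⟩
  · by_cases hne : q = y
    · subst hne
      refine Or.inr ⟨hI.up C q h1, fun x b hx => ?_⟩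
      rcases h2 with rfl | ⟨z, d, -, h2, -⟩ | ⟨z, b, -, h2, -⟩
      · obtain ⟨d, hd, -⟩ := hx.concat
        simp at hd
      · exact h2 x b hx
      · exact h2
    · refine Or.inl ?_
      rcases h2 with rfl | ⟨z, d, rfl, -, C', y', h2, h3⟩ | ⟨z, b, hb, -, h2, h3⟩
      · simp at hq
        exact absurd hq hne
      · exact ⟨C', y', h2, ((prefix_concat.1 hq).resolve_left hne).trans h3⟩
      · have hv := (sub_sibling hb (hI.valid C y hy)).1
        obtain ⟨d, rfl, -⟩ := hb.concat
        obtain ⟨d', hd', -⟩ := hb.symm.concat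
        rcases hI.branch z b _ (hI.started_of_at_concat (Or.inr h1)) hb.symm hv with h4 |
          ⟨C', y', h4, h5⟩
        · exact absurd h4 h2
        · refine ⟨C', y', h3 C' y' h4 ?_, ((prefix_concat.1 hq).resolve_left hne).trans ?_⟩
          · rintro rfl
            exact hb.symm.not_prefix h5
          · rw [hd'] at h5
            exact prefix_of_concat_prefix h5

theorem progress_step (h : Step Pi prio s e s') {q : Path} (hq : Started (tr ++ e.toList) q) :
    Performed Pi (tr ++ e.toList) q ∨ ∃ C y, Tok s' C y ∧ q <+: y := by
  have old : ∀ C y, Tok s C y → q <+: y →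
      Performed Pi (tr ++ e.toList) q ∨ ∃ C y, Tok s' C y ∧ q <+: y := by
    intro C y h1 h2
    rcases hI.forward h h1 h2 with h3 | h3
    · exact Or.inr h3
    · exact Or.inl (h3.1.mono _)
  rcases started_append.1 hq with hq | ⟨C, he⟩
  · rcases hI.progress q hq with h1 | ⟨C, y, h1, h2⟩
    · exact Or.inl (h1.mono _)
    · exact old C y h1 h2
  · exact old C q (Or.inl (Or.inl (h.core_of_start he))) List.prefix_rfl

theorem branch_step (h : Step Pi prio s e s') {q a b : Path} (hq : Started (tr ++ e.toList) q)
    (hab : Sibling q a b) (ha : Pi.sub a ≠ none) :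
    a ∈ s'.done ∨ ∃ C y, Tok s' C y ∧ a <+: y := by
  rcases started_append.1 hq with hq | ⟨C, he⟩
  · rcases hI.branch q a b hq hab ha with h1 | ⟨C, y, h1, h2⟩
    · exact Or.inl (h.done_subset h1)
    · rcases hI.forward h h1 h2 with h3 | h3
      · exact Or.inr h3
      · exact Or.inl (h3.2 q b hab)
  · obtain ⟨-, hd, l, r, tl, hf⟩ := sub_sibling hab ha
    refine Or.inr ⟨C, a, ?_, List.prefix_rfl⟩
    have : (a = q ++ [.forkL] ∨ a = q ++ [.forkR]) := by
      rcases hab with ⟨h, -⟩ | ⟨h, -⟩ <;> simp [h]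
    unfold Tok At
    cases h <;> simp only [reduceCtorEq, Option.some.injEq, Event.start.injEq] at he <;> grind

theorem step (h : Step Pi prio s e s') : Inv Pi (tr ++ e.toList) s' where
  root := by
    rcases hI.root with h1 | ⟨C, h1⟩
    · exact Or.inl (h1.mono _)
    · by_cases hs : Started (tr ++ e.toList) []
      · exact Or.inl hs
      · refine Or.inr ⟨C, ?_⟩
        have hn : e ≠ some (.start C []) := by
          intro he
          exact hs (started_append.2 (Or.inr ⟨C, he⟩))
        cases h <;> simp only [Function.update_apply] <;> grind
  valid_started q hq := by
    rcases started_append.1 hq with hq | ⟨C, he⟩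
    · exact hI.valid_started q hq
    · exact hI.valid C q (Or.inl (Or.inl (h.core_of_start he)))
  valid _ _ := hI.valid_step h
  fresh _ _ := hI.fresh_step h
  parent _ _ hy _ := hI.parent_step h hy
  closed _ _ := hI.closed_step h
  up _ _ := hI.up_step h
  done _ := hI.done_step h
  before _ := hI.before_step h
  cross _ _ _ _ := hI.cross_step h
  shape _ _ := hI.shape_step h
  sorted := hI.sorted_step h
  chain _ _ := hI.chain_step h
  progress _ := hI.progress_step h
  branch _ _ _ := hI.branch_step h
  unique C C' q h1 h2 := by
    simp only [List.mem_append, Option.mem_toList] at h1 h2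
    -- A part started now was ready, hence unstarted before, so no second start is possible.
    have new : e = some (.start C q) ∨ e = some (.start C' q) → ¬ Started tr q := by
      rintro (he | he)
      · exact hI.fresh C q (Or.inl (h.core_of_start he))
      · exact hI.fresh C' q (Or.inl (h.core_of_start he))
    rcases h1 with h1 | h1 <;> rcases h2 with h2 | h2
    · exact hI.unique C C' q h1 h2
    · exact absurd ⟨C, h1⟩ (new (Or.inr h2))
    · exact absurd ⟨C', h2⟩ (new (Or.inl h1))
    · simpa using h1.symm.trans h2
  joined C q h1 := by
    simp only [List.mem_append, Option.mem_toList] at h1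
    rcases h1 with h1 | rfl
    · exact (hI.joined C q h1).mono _
    · refine Started.mono ?_ _
      cases h with
      | join hc hab hb hd =>
        obtain ⟨d, rfl, -⟩ := hab.concat
        exact hI.started_of_at_concat (Or.inr hc)

end Inv

theorem Inv.init (C₀ : Fin p) : Inv Pi [] (Config.init C₀) := by
  have tok : ∀ C y, Tok (Config.init C₀) C y → C = C₀ ∧ y = [] := by
    intro C y h
    simp only [Tok, At, Config.init, Function.update_apply] at h
    grind
  have st : ∀ q, ¬ Started ([] : List (Event p)) q := by simp [Started]
  constructor
  · exact Or.inr ⟨C₀, by simp [Config.init]⟩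
  · exact fun q h => absurd h (st q)
  · intro C y h
    simp [(tok C y h).2, Comp.sub_nil]
  · exact fun _ y _ => st y
  · intro C y h x hx hne
    rw [(tok C y h).2] at hx hne
    exact absurd (List.prefix_nil.1 hx) hne
  · exact fun q q' _ h => absurd h (st q')
  · intro C q h
    simp only [Config.init, Function.update_apply] at h
    grind
  · simp [Config.init]
  · rintro q (h | ⟨C, y, h1, h2⟩)
    · exact absurd h (st _)
    · simp [(tok C y h1).2] at h2
  · intro C C' x y h1 h2 _
    rw [(tok C x h1).1, (tok C' y h2).1]
  · simp [Config.init]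
  · simp [Config.init]
  · simp [Config.init]
  · exact fun q h => absurd h (st q)
  · exact fun q _ _ h => absurd h (st q)
  · simp
  · simp

theorem Run.inv (h : Run Pi prio C₀ tr s) : Inv Pi tr s := by
  induction h with
  | init => exact Inv.init C₀
  | step _ hst ih => exact ih.step hst

-- Unstarted work and the priority of a round

/-- A part that has not been started lies in, or follows, a part held by some core. -/
theorem Inv.exists_tok_of_not_started (hI : Inv Pi tr s) {q : Path} (hq : Pi.sub q ≠ none)
    (hs : ¬ Started tr q) : ∃ C y, Tok s C y ∧ (y <+: q ∨ Follows y q) := by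
  -- Descend from a started ancestor to the first unstarted step `d`. A fork branch is located by
  -- `branch`; otherwise `progress` gives a token somewhere inside `q₀`.
  have main : ∀ u q₀ : Path, q = q₀ ++ u → Started tr q₀ →
      ∃ C y, Tok s C y ∧ (y <+: q ∨ Follows y q) := by
    intro u
    induction u with
    | nil =>
      rintro q₀ rfl h0
      simp at hs
      exact absurd h0 hs
    | cons d u ih =>
      rintro q₀ rfl h0
      by_cases hd : Started tr (q₀ ++ [d])
      · exact ih (q₀ ++ [d]) (by simp) hd
      have hpre : q₀ ++ [d] <+: q₀ ++ d :: u := ⟨u, by simp⟩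
      have hv := Comp.sub_ne_none_of_prefix hpre hq
      have inside : ∀ C y, Tok s C y → q₀ ++ [d] <+: y → y = q₀ ++ [d] := by
        intro C y h1 h2
        by_contra hne
        exact hd (hI.parent C y h1 _ h2 (Ne.symm hne))
      have notPerf : ∀ q', q' <+: q₀ ++ [d] → ¬ Performed Pi tr q' := by
        intro q' h1 h2
        obtain ⟨z, hz⟩ := Option.ne_none_iff_exists'.1 hv
        exact hd (h2 _ z h1 hz).1
      have good : ∀ C y, Tok s C y → q₀ ++ [d] <+: y →
          ∃ C y, Tok s C y ∧ (y <+: q₀ ++ d :: u ∨ Follows y (q₀ ++ d :: u)) := by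
        intro C y h1 h2
        obtain rfl := inside C y h1 h2
        exact ⟨C, _, h1, Or.inl hpre⟩
      obtain ⟨x, hx⟩ := Option.ne_none_iff_exists'.1 (hI.valid_started q₀ h0)
      have hk := sub_children hx hv
      by_cases hf : d = .forkL ∨ d = .forkR
      · obtain ⟨b, hb⟩ : ∃ b, Sibling q₀ (q₀ ++ [d]) b := by
          rcases hf with rfl | rfl
          · exact ⟨_, Or.inl ⟨rfl, rfl⟩⟩
          · exact ⟨_, Or.inr ⟨rfl, rfl⟩⟩
        rcases hI.branch q₀ _ b h0 hb hv with h1 | ⟨C, y, h1, h2⟩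
        · exact absurd (hI.done _ h1).1 hd
        · exact good C y h1 h2
      · rcases hI.progress q₀ h0 with h1 | ⟨C, y, h1, h2⟩
        · exact absurd h1 (notPerf q₀ (List.prefix_append _ _))
        · rcases prefix_cases h2 with rfl | ⟨d', hd'⟩
          · rcases h1 with (h1 | h1) | h1
            · exact absurd h0 (hI.fresh C y (Or.inl h1))
            · exact absurd (hI.up C y h1) (notPerf y (List.prefix_append _ _))
            · exact absurd h0 (hI.fresh C y (Or.inr h1))
          · by_cases hdd : d' = d
            · subst hdd
              exact good C y h1 hd'
            have hk' := sub_children hx (Comp.sub_ne_none_of_prefix hd' (hI.valid C y h1))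
            -- A token in another child forces a sequence. In its first half the token precedes `q`;
            -- in its second half it would mean that the unstarted first half was performed.
            obtain ⟨rfl, rfl⟩ | ⟨rfl, rfl⟩ : d = .seqR ∧ d' = .seqL ∨ d = .seqL ∧ d' = .seqR := by
              rcases hk with ⟨_, _, rfl, h⟩ | ⟨_, _, _, _, -, h⟩ | ⟨_, _, rfl, h⟩
              · simp only [reduceCtorEq, false_and, exists_false, or_false] at hk'
                grind
              · exact absurd h hf
              · simp only [reduceCtorEq, false_and, exists_false, false_or] at hk'
                grind
            · obtain ⟨v, rfl⟩ := hd'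
              exact ⟨C, _, h1, Or.inr ⟨q₀, v, u, by simp, rfl⟩⟩
            · exact absurd (hI.before q₀ (Or.inr ⟨C, y, h1, hd'⟩)).2.1
                (notPerf _ List.prefix_rfl)
  rcases hI.root with h | ⟨C, h⟩
  · exact main q [] rfl h
  · exact ⟨C, [], Or.inl (Or.inl h), Or.inl List.nil_prefix⟩

/-- During a round of priority `d` all parts of larger priority have been started. -/
theorem Run.started_of_round_lt (hprio : IsPriority Pi prio) (h : Run Pi prio C₀ tr s) {d : ℤ}
    (hd : s.round = some d) {q : Path} (hq : Pi.sub q ≠ none) (hlt : d < prio q) :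
    Started tr q := by
  induction h generalizing d with
  | init => simp [Config.init] at hd
  | @step tr s s' e hrun hst ih =>
    by_cases hr : s.round = some d
    · exact (ih hr hlt).mono _
    have hI := hrun.inv
    cases hst
    case newRound q₀ _ hbusy _ hmax =>
      obtain rfl : prio q₀ = d := by simpa using hd
      by_contra hs
      simp only [Option.toList_none, List.append_nil] at hs
      obtain ⟨C, y, hy, hyq⟩ := hI.exists_tok_of_not_started hq hs
      -- Lower tasks of a queue lie in the left sibling of its head, which has the head's priority.
      have inQueue : ∀ C, ∀ y ∈ s.queue C, prio y ≤ prio q₀ := by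
        intro C y hy
        have hs := hI.sorted C
        cases hC : s.queue C with
        | nil => simp [hC] at hy
        | cons z ts =>
          have hz : prio z ≤ prio q₀ := hmax z ⟨C, ts, hC⟩
          rw [hC] at hy hs
          rcases List.mem_cons.1 hy with rfl | hy
          · exact hz
          · obtain ⟨r, rfl, h2⟩ := (List.pairwise_cons.1 hs).1 y hy
            have hvR := hI.valid C (r ++ [.forkR]) (Or.inr (by simp [hC]))
            have hvL := (sub_sibling (Or.inr ⟨rfl, rfl⟩) hvR).1
            have hvy := hI.valid C y (Or.inr (by simp [hC, hy]))
            have := hprio.mono _ _ hvL hvy h2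
            have := hprio.same _ _ hvL hvR (place_fork_concat r)
            omega
      have hle : prio q ≤ prio q₀ := by
        have hvy := hI.valid C y hy
        rcases hy with hy | hy
        · have hne : s.core C ≠ .idle := by
            rintro h
            simp [At, h] at hy
          -- The end of a round guarantees a queued task `r ++ [.forkR]`; the core is in its left
          -- sibling, so that sibling's priority is the one to compare with.
          obtain ⟨z, hz⟩ := List.exists_mem_of_ne_nil _ (hbusy C hne)
          obtain ⟨r, rfl⟩ := hI.shape C z hz
          obtain ⟨y', hy', hry, -⟩ := hI.chain C r hz
          obtain rfl := hy.unique hy'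
          have hvL := Comp.sub_ne_none_of_prefix hry hvy
          have h1 := hI.valid C _ (Or.inr hz)
          have h2 := hprio.same _ _ hvL h1 (place_fork_concat r)
          have h3 := inQueue C _ hz
          suffices prio q ≤ prio (r ++ [.forkL]) by omega
          rcases hyq with hyq | ⟨w, u, v, rfl, rfl⟩
          · exact hprio.mono _ _ hvL hq (hry.trans hyq)
          -- If the sequence separating `y` from `q` is inside `r ++ [.forkL]`, then so is `q`;
          -- otherwise `q` follows `r ++ [.forkL]`.
          · rcases List.prefix_or_prefix_of_prefix hry (List.prefix_append w _) with h4 | h4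
            · exact hprio.mono _ _ hvL hq (h4.trans (List.prefix_append _ _))
            · rcases prefix_cases h4 with h4 | ⟨d, h4⟩
              · exact hprio.mono _ _ hvL hq (h4 ▸ List.prefix_append _ _)
              · obtain rfl : d = .seqL := eq_of_concat_prefix (h4.trans hry) ⟨u, by simp⟩
                obtain ⟨u', hu'⟩ := h4
                exact (hprio.strict _ _ hvL hq
                  (Or.inr ⟨w, u', v, by simp [← hu'], rfl⟩)).le
        · have h1 := inQueue C y hy
          rcases hyq with hyq | hyq
          · exact (hprio.mono _ _ hvy hq hyq).trans h1
          · exact (hprio.strict _ _ hvy hq (Or.inr hyq)).le.trans h1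
      omega
    all_goals exact absurd hd hr

-- Thefts inside the members of a collection

theorem Step.of_steal (h : Step Pi prio s e s') {C V : Fin p} {q : Path}
    (he : e = some (.steal C V q)) :
    s.core C = .idle ∧ q ∈ s.queue V ∧ s.round = some (prio q) := by
  cases h <;> simp_all

theorem Step.of_join (h : Step Pi prio s e s') {C : Fin p} {q : Path}
    (he : e = some (.join C q)) : ∃ d, s.core C = .up (q ++ [d]) := by
  cases h with
  | join hc hab hb hd =>
    obtain ⟨d, rfl, -⟩ := hab.concat
    simp only [Option.some.injEq, Event.join.injEq] at he
    obtain ⟨rfl, rfl⟩ := he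
    exact ⟨d, hc⟩
  | _ => simp at he

/-- A proper subtask of the part at `h` has been stolen. -/
def StolenWithin (tr : List (Event p)) (h : Path) : Prop :=
  ∃ C V q, Event.steal C V q ∈ tr ∧ h <+: q ∧ q ≠ h

theorem stolenWithin_append {h : Path} : StolenWithin (tr ++ e.toList) h ↔
    StolenWithin tr h ∨ ∃ C V q, e = some (.steal C V q) ∧ h <+: q ∧ q ≠ h := by
  simp only [StolenWithin, List.mem_append, Option.mem_toList, or_and_right, exists_or]

/-- If no proper subtask of `h` has been stolen, then everything in `h` is executed by the core
that started `h`. -/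
theorem Run.owner (hrun : Run Pi prio C₀ tr s) {C : Fin p} {h : Path}
    (hC : Event.start C h ∈ tr) (hh : ¬ StolenWithin tr h) :
    (∀ C' y, Tok s C' y → h <+: y → C' = C) ∧
      ∀ C' q, h <+: q → Event.start C' q ∈ tr ∨ Event.join C' q ∈ tr → C' = C := by
  induction hrun with
  | init => simp at hC
  | @step tr s s' e hrun hst ih =>
    have hI := hrun.inv
    have hI' := hI.step hst
    rw [stolenWithin_append, not_or] at hh
    have old : (∀ C' y, Tok s C' y → h <+: y → C' = C) ∧
        ∀ C' q, h <+: q → Event.start C' q ∈ tr ∨ Event.join C' q ∈ tr → C' = C := by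
      rcases List.mem_append.1 hC with hC | hC
      · exact ih hC hh.1
      · have hd := hst.core_of_start (Option.mem_toList.1 hC)
        have hn := hI.fresh C h (Or.inl hd)
        -- If this step starts `h`, nothing inside `h` has been executed yet, and by `solo` the only
        -- token there is the position of `C`.
        refine ⟨fun C' y h1 h2 => (hI.solo (Or.inl (Or.inl hd)) h1 h2).1.symm, ?_⟩
        rintro C' q hq (h1 | h1)
        · exact absurd (hI.closed h q hq ⟨C', h1⟩) hn
        · exact absurd (hI.closed h q hq (hI.joined C' q h1)) hn
    refine ⟨fun C' y hy hhy => ?_, fun C' q hq hE => ?_⟩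
    · rcases hst.of_tok_prefix hy hhy with ⟨x, hx, hx'⟩ | ⟨V, he, hV⟩ | ⟨rfl, hr, -⟩
      · exact old.1 C' x hx' hx
      · by_cases hne : y = h
        · exact absurd ⟨C, hC⟩ (hI'.fresh C' h (by
            subst hne
            cases hst <;> simp_all [Ready]))
        · exact absurd ⟨C', V, y, he, hhy, hne⟩ hh.2
      · exact absurd ⟨C, hC⟩ (hI'.fresh C' _ hr)
    · simp only [List.mem_append, Option.mem_toList] at hE
      rcases hE with (hE | hE) | (hE | hE)
      · exact old.2 C' q hq (Or.inl hE)
      · exact old.1 C' q (Or.inl (Or.inl (hst.core_of_start hE))) hq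
      · exact old.2 C' q hq (Or.inr hE)
      · obtain ⟨d, hd⟩ := hst.of_join hE
        exact old.1 C' _ (Or.inl (Or.inr hd)) (hq.trans (List.prefix_append _ _))

/-- Proper subtasks are stolen in at most `p - 1` members of a collection: when this happens
for the first time, all members have been started, and each one that is not yet completed
occupies a core other than the thief. -/
theorem Run.stolenWithin_collection (hprio : IsPriority Pi prio) (hrun : Run Pi prio C₀ tr s)
    {k : ℕ} {H : Fin k → Path} (hH : IsCollection Pi H) :
    (∀ i, ¬ StolenWithin tr (H i)) ∨ ∃ S : Finset (Fin k), S.card ≤ p - 1 ∧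
      ∀ i ∉ S, Started tr (H i) ∧ (∀ C y, Tok s C y → ¬ H i <+: y) ∧
        ¬ StolenWithin tr (H i) := by
  classical
  induction hrun with
  | init => simp [StolenWithin]
  | @step tr s s' e hrun hst ih =>
    have hI := hrun.inv
    have hI' := hI.step hst
    -- A started member without tokens stays so, and a theft inside it would need a queued task
    -- there.
    have keep : ∀ i, Started tr (H i) → (∀ C y, Tok s C y → ¬ H i <+: y) →
        ¬ StolenWithin tr (H i) → Started (tr ++ e.toList) (H i) ∧
          (∀ C y, Tok s' C y → ¬ H i <+: y) ∧ ¬ StolenWithin (tr ++ e.toList) (H i) := by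
      intro i h1 h2 h3
      refine ⟨h1.mono _, fun C y hy hiy => ?_, ?_⟩
      · rcases hst.of_tok_prefix hy hiy with ⟨x, hx, hx'⟩ | ⟨V, -, hV⟩ | ⟨rfl, hr, -⟩
        · exact h2 C x hx' hx
        · exact h2 V y (Or.inr hV) hiy
        · exact hI'.fresh C _ hr (h1.mono _)
      · rw [stolenWithin_append]
        rintro (h4 | ⟨C, V, q, he, hq, -⟩)
        · exact h3 h4
        · exact h2 V q (Or.inr (hst.of_steal he).2.1) hq
    rcases ih with ih | ⟨S, hS, ih⟩
    · by_cases hne : ∃ i C V q, e = some (.steal C V q) ∧ H i <+: q ∧ q ≠ H i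
      swap
      · refine Or.inl fun i hi => ?_
        rcases stolenWithin_append.1 hi with hi | hi
        · exact ih i hi
        · exact hne ⟨i, hi⟩
      refine Or.inr ?_
      obtain ⟨j, T, V, q, he, hjq, hq⟩ := hne
      obtain ⟨hidle, hV, hround⟩ := hst.of_steal he
      have hvq := hI.valid V q (Or.inr hV)
      -- Only right branches are queued, so a proper subtask is reached through a fork and is
      -- strictly deeper.
      have hlt : prio q < prio (H j) := by
        refine hprio.strict _ _ (hH.valid j) hvq (Or.inl ?_)
        obtain ⟨r, rfl⟩ := hI.shape V q hV
        obtain ⟨u, hu⟩ := (prefix_concat.1 hjq).resolve_left (Ne.symm hq)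
        exact ⟨u ++ [.forkR], by simp [← hu], by simp⟩
      have hst' : ∀ i, Started tr (H i) := by
        intro i
        refine hrun.started_of_round_lt hprio hround (hH.valid i) ?_
        rwa [hprio.same _ _ (hH.valid i) (hH.valid j) (hH.samePlace i j)]
      -- A queued task inside `H i` is not `H i` itself, which has been started; hence its fork is
      -- inside `H i`, and with it the core that owns the queue.
      have hat : ∀ i, (∃ C y, Tok s C y ∧ H i <+: y) → ∃ C y, At s C y ∧ H i <+: y := by
        rintro i ⟨C, y, hy | hy, hiy⟩
        · exact ⟨C, y, hy, hiy⟩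
        · obtain ⟨r, rfl⟩ := hI.shape C y hy
          obtain ⟨z, hz, hrz, -⟩ := hI.chain C r hy
          refine ⟨C, z, hz, ((prefix_concat.1 hiy).resolve_left fun h => ?_).trans
            (prefix_of_concat_prefix hrz)⟩
          exact hI.fresh C _ (Or.inr hy) (h ▸ hst' i)
      let S := Finset.univ.filter fun i => ∃ C y, At s C y ∧ H i <+: y
      -- `S` collects the unfinished members; outside `S` the value `T` is a mere default.
      have hchoice : ∀ i, ∃ C, i ∈ S → ∃ y, At s C y ∧ H i <+: y := by
        intro i
        by_cases hi : i ∈ S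
        · obtain ⟨C, y, h⟩ := (Finset.mem_filter.1 hi).2
          exact ⟨C, fun _ => ⟨y, h⟩⟩
        · exact ⟨T, fun h => absurd h hi⟩
      choose f hf using hchoice
      refine ⟨S, ?_, fun i hi => keep i (hst' i) ?_ (ih i)⟩
      -- The idle thief `T` is in no member, whence `p - 1`. A core in two members would make their
      -- paths comparable, hence equal.
      · calc S.card ≤ (Finset.univ.erase T).card := by
              refine Finset.card_le_card_of_injOn f ?_ ?_
              · intro i hi
                obtain ⟨y, hy, -⟩ := hf i hi
                simp only [Finset.coe_erase, Finset.coe_univ, Set.mem_sdiff, Set.mem_univ,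
                  Set.mem_singleton_iff, true_and]
                intro h
                rw [h] at hy
                simp [At, hidle] at hy
              · intro i hi i' hi' hii
                obtain ⟨y, hy, hiy⟩ := hf i hi
                obtain ⟨y', hy', hiy'⟩ := hf i' hi'
                rw [← hii] at hy'
                obtain rfl := hy.unique hy'
                apply hH.injective
                rcases List.prefix_or_prefix_of_prefix hiy hiy' with h | h
                · exact hprio.eq_of_prefix (hH.valid i) (hH.valid i') (hH.samePlace i i') h
                · exact (hprio.eq_of_prefix (hH.valid i') (hH.valid i) (hH.samePlace i' i) h).symm
          _ = p - 1 := by simp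
      · intro C y hy hiy
        obtain ⟨C', y', h⟩ := hat i ⟨C, y, hy, hiy⟩
        exact hi (Finset.mem_filter.2 ⟨Finset.mem_univ _, C', y', h⟩)
    · refine Or.inr ⟨S, hS, fun i hi => ?_⟩
      obtain ⟨h1, h2, h3⟩ := ih i hi
      exact keep i h1 h2 h3

/-- A core can be semi-usurped only if a proper subtask of the first computation was stolen. -/
theorem IsSemiUsurped.stolenWithin (hrun : Run Pi prio C₀ tr s) {h₁ h₂ : Path} {C : Fin p}
    (hfol : Follows h₁ h₂) (h : IsSemiUsurped Pi tr h₁ h₂ C) : StolenWithin tr h₁ := by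
  by_contra hn
  obtain ⟨hs₁, hs₂, x₁, x₂, w, hx₁, -, hw, -, hacc⟩ := h
  have hI := hrun.inv
  have ho := (hrun.owner hs₁ hn).2
  obtain ⟨z, u, v, rfl, rfl⟩ := hfol
  -- `h₂` lies in the second half of the sequence at `z`, so its start means that the first half,
  -- which contains `h₁`, has been performed completely.
  have hperf := (hI.before z (Or.inl (hI.closed _ _ ⟨v, by simp⟩ ⟨C, hs₂⟩))).2.1
  obtain ⟨u', y, hy, hop⟩ := Comp.exists_sub_of_mem_words hw
  have hsub : Pi.sub (z ++ Dir.seqL :: u ++ u') = some y := by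
    rw [Comp.sub_append, hx₁, Option.bind_some, hy]
  obtain ⟨⟨C', hC'⟩, hj⟩ := hperf (z ++ Dir.seqL :: u ++ u') y ⟨u ++ u', by simp⟩ hsub
  refine hacc ⟨_, y, List.prefix_append _ _, hsub, ?_⟩
  rcases hop with hop | hop
  · obtain rfl := ho C' _ (List.prefix_append _ _) (Or.inl hC')
    exact Or.inl ⟨hC', hop⟩
  · refine Or.inr ⟨?_, hop⟩
    cases y with
    | fork hd l r tl =>
      obtain ⟨C'', hC''⟩ := hj hd l r tl rfl
      obtain rfl := ho C'' _ (List.prefix_append _ _) (Or.inr hC'')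
      exact hC''
    | _ => simp [Comp.joinOps] at hop

end PWS

open PWS in
theorem mainTheorem9 {W : Type*} {p k : ℕ} (P : Constants) (t : ℕ) (Pi : Comp W)
    (hPi : IsBalancedHBP P t Pi)
    (prio : Path → ℤ) (hprio : IsPriority Pi prio)
    (C₀ : Fin p) (tr : List (Event p)) (s : Config p) (hrun : Run Pi prio C₀ tr s)
    (H₁ H₂ : Fin k → Path) (hH₁ : IsCollection Pi H₁) (hH₂ : IsCollection Pi H₂)
    (hsucc : ∀ i, Follows (H₁ i) (H₂ i)) :
    {x : Fin k × Fin p | IsUsurper tr (H₁ x.1) (H₂ x.1) x.2 ∨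
      IsSemiUsurped Pi tr (H₁ x.1) (H₂ x.1) x.2}.ncard ≤ p - 1 := by
  set A := {x : Fin k × Fin p | IsUsurper tr (H₁ x.1) (H₂ x.1) x.2 ∨
      IsSemiUsurped Pi tr (H₁ x.1) (H₂ x.1) x.2} with hA
  have hsteal : ∀ x ∈ A, StolenWithin tr (H₁ x.1) := by
    rintro x (⟨-, -, V, q, h⟩ | h)
    · exact ⟨x.2, V, q, h⟩
    · exact h.stolenWithin hrun (hsucc x.1)
  have hstart : ∀ x ∈ A, Event.start x.2 (H₂ x.1) ∈ tr := by
    rintro x (h | h)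
    · exact h.1
    · exact h.2.1
  rcases hrun.stolenWithin_collection hprio hH₁ with h | ⟨S, hS, h⟩
  · have : A = ∅ := Set.eq_empty_of_forall_notMem fun x hx => h x.1 (hsteal x hx)
    simp [this]
  · refine le_trans ?_ hS
    rw [← Set.ncard_coe_finset]
    -- Projection to the index is injective because only one core starts `H₂ i`.
    refine Set.ncard_le_ncard_of_injOn Prod.fst ?_ ?_ (Finset.finite_toSet S)
    · intro x hx
      by_contra hn
      exact (h x.1 hn).2.2 (hsteal x hx)
    · rintro ⟨i, C⟩ hx ⟨i', C'⟩ hx' hii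
      obtain rfl : i = i' := hii
      have := hrun.inv.unique C C' (H₂ i) (hstart _ hx) (hstart _ hx')
      rw [this]
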